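/- Setting. The state $\theta\in[0,1]$ is drawn from a prior $F$. An instance $(F,u)$ consists of a prior $F$ and an upper semicontinuous $u:[0,1]\to[0,1]$. A $K$-signaling scheme $\pi$ sends, in state $\theta$, a random signal $s\sim\pi(\cdot\mid\theta)$ from a set of at most $K$ signals; with $\mu_{\pi,s}=\mathbb E[\theta\mid s]$ its posterior means, its value is $U(\pi)=\mathbb E_{\theta\sim F}\,\mathbb E_{s\sim\pi(\cdot\mid\theta)}[u(\mu_{\pi,s})]$. It is $K$-partitional if there are points $0=a_0\le a_1\le\dots\le a_K=1$ such that signal $i$ is sent only by states in $[a_{i-1},a_i]$ (so states inside $(a_{i-1},a_i)$ send signal $i$ with certainty; a state at a partition point may randomize among the signals of the cells containing it, which matters only if $F$ has atoms). Let $\mathrm{OPT}_{F,u}(K)$ and $\mathrm{OPT}^{\mathrm{Part}}_{F,u}(K)$ be the maximal values of $U$ over $K$-signaling schemes and over $K$-partitional policies, and, if $\mathrm{OPT}_{F,u}(K)>0$, let $\mathrm{PoE}((F,u),K)=\mathrm{OPT}^{\mathrm{Part}}_{F,u}(K)/\mathrm{OPT}_{F,u}(K)$. Call a prior continuous with full support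 if it has a density on $[0,1]$ and gives positive probability to every nonempty (relatively) open subset of $[0,1]$. Theorem. (1) For every instance $(F,u)$ whose prior is continuous with full support and every $K\ge2$, both maxima are attained and $\mathrm{OPT}^{\mathrm{Part}}_{F,u}(K)\ge\frac12\,\mathrm{OPT}_{F,u}(K)$. (2) For every $\varepsilon>0$ there is an instance $(F,u)$ whose prior is continuous with full support such that, for all $K\ge2$, $\mathrm{OPT}_{F,u}(K)>0$ and $\mathrm{PoE}((F,u),K)\le\frac12+\varepsilon$. There is also such an instance whose prior is instead supported on exactly three points (for it, too, both maxima are attained). (3) Consequently, for every $K\ge2$, $\inf_{(F,u)}\mathrm{PoE}((F,u),K)=\frac12$, the infimum being over all instances whose prior is continuous with full support and for which $\mathrm{OPT}_{F,u}(K)>0$. -/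

import Mathlib

open MeasureTheory ProbabilityTheory unitInterval

noncomputable section

namespace InfoDesign

/-- A prior on the state space `[0,1]` that is continuous (it has a density with respect to
Lebesgue measure) and has full support (every nonempty open set has positive probability). -/
structure IsContinuousPrior (F : Measure I) : Prop where
  isProbabilityMeasure : IsProbabilityMeasure F
  absolutelyContinuous : F ≪ volume
  fullSupport : F.IsOpenPosMeasure

/-- A prior on `[0,1]` supported on exactly three points. -/
structure IsThreePointPrior (F : Measure I) : Prop where
  isProbabilityMeasure : IsProbabilityMeasure F
  threePoints : ∃ T : Finset I, T.card = 3 ∧ F (T : Set I)ᶜ = 0 ∧ ∀ x ∈ T, F {x} ≠ 0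

/-- The unconditional probability of the signal `s` under the policy `π`. -/
def signalProb (F : Measure I) {K : ℕ} (π : Kernel I (Fin K)) (s : Fin K) : ℝ :=
  ∫ θ, (π θ).real {s} ∂F

/-- The integral of the state over the event that the signal `s` is sent. -/
def signalMoment (F : Measure I) {K : ℕ} (π : Kernel I (Fin K)) (s : Fin K) : ℝ :=
  ∫ θ, (θ : ℝ) * (π θ).real {s} ∂F

theorem moment_div_prob_mem (F : Measure I) {K : ℕ} (π : Kernel I (Fin K)) (s : Fin K) :
    signalMoment F π s / signalProb F π s ∈ Set.Icc (0 : ℝ) 1 := by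
  have h0 : 0 ≤ signalMoment F π s :=
    integral_nonneg fun θ => mul_nonneg θ.2.1 measureReal_nonneg
  have h1 : 0 ≤ signalProb F π s := integral_nonneg fun θ => measureReal_nonneg
  refine ⟨div_nonneg h0 h1, ?_⟩
  by_cases hint : Integrable (fun θ => (π θ).real {s}) F
  · refine div_le_one_of_le₀ ?_ h1
    refine integral_mono_of_nonneg
      (Filter.Eventually.of_forall fun θ => mul_nonneg θ.2.1 measureReal_nonneg) hint
      (Filter.Eventually.of_forall fun θ => ?_)
    exact mul_le_of_le_one_left measureReal_nonneg θ.2.2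
  · have : signalProb F π s = 0 := integral_undef hint
    simp [this]

/-- The receiver's posterior mean of the state after the signal `s` (the value at a signal of
probability zero is irrelevant). -/
def posteriorMean (F : Measure I) {K : ℕ} (π : Kernel I (Fin K)) (s : Fin K) : I :=
  ⟨signalMoment F π s / signalProb F π s, moment_div_prob_mem F π s⟩

/-- The designer's expected utility `U(π)`: the expectation, over the state `θ ∼ F` and the signal
`s ∼ π(· ∣ θ)`, of the interim utility of the posterior mean. -/
def expectedUtility (F : Measure I) (u : I → I) {K : ℕ} (π : Kernel I (Fin K)) : ℝ :=
  ∫ θ, ∫ s, (u (posteriorMean F π s) : ℝ) ∂(π θ) ∂F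

/-- `π` is `K`-partitional: there are partition points `0 = a₀ ≤ a₁ ≤ ⋯ ≤ a_K = 1` such that the
signal `i` is sent only in the closed cell between its two partition points. So a state in the
interior of a cell deterministically sends the signal of that cell, and a state at a partition
point may randomize among the signals of the cells that it belongs to. -/
def IsPartitional {K : ℕ} (π : Kernel I (Fin K)) : Prop :=
  ∃ a : Fin (K + 1) → I, Monotone a ∧ a 0 = 0 ∧ a (Fin.last K) = 1 ∧
    ∀ (i : Fin K) (θ : I), π θ {i} ≠ 0 → a i.castSucc ≤ θ ∧ θ ≤ a i.succ

/-- The expected utilities of the policies with at most `K` signals (some of the `K` signals may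
never be sent). -/
def schemeValues (F : Measure I) (u : I → I) (K : ℕ) : Set ℝ :=
  {v | ∃ π : Kernel I (Fin K), IsMarkovKernel π ∧ expectedUtility F u π = v}

/-- The expected utilities of the `K`-partitional policies. -/
def partitionalValues (F : Measure I) (u : I → I) (K : ℕ) : Set ℝ :=
  {v | ∃ π : Kernel I (Fin K), IsMarkovKernel π ∧ IsPartitional π ∧ expectedUtility F u π = v}

/-- The optimal value of unrestricted `K`-signaling schemes. -/
def opt (F : Measure I) (u : I → I) (K : ℕ) : ℝ := sSup (schemeValues F u K)

/-- The optimal value of `K`-partitional policies. -/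
def optPart (F : Measure I) (u : I → I) (K : ℕ) : ℝ := sSup (partitionalValues F u K)

/-- The two optimal values are attained, that is, they are maxima. -/
def OptimaAttained (F : Measure I) (u : I → I) (K : ℕ) : Prop :=
  IsGreatest (schemeValues F u K) (opt F u K) ∧
    IsGreatest (partitionalValues F u K) (optPart F u K)

/-- The price of explainability (meaningful if `opt F u K` is positive). -/
def poe (F : Measure I) (u : I → I) (K : ℕ) : ℝ := optPart F u K / opt F u K

end InfoDesign

end

/-! Lower bound. Only the law of the posterior mean matters: at most `K` atoms `x` with weights `w
x`, having the mass and the moment of the prior and, by Jensen, obeying the put inequalities `∑ w x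
* max (c - x) 0 ≤ ∫ max (c - θ) 0 ∂F`. These necessary conditions suffice for an induction on the
number of atoms over an interval `[a,b]`. With three or more atoms, some direction of weights
preserves mass and moment and does not lower the value. Moving along it as far as the constraints
allow (`IsPooling.exists_extremal`) either kills an atom or makes a put inequality tight at an
interior strike `c`. In the latter case no mass is pooled across `c`, so the problem splits into
`[a,c]` and `[c,b]`, whose atom counts add up (`IsPooling.split`). One atom is the whole cell. For
two atoms `x < y`, some initial cell has mean `x` and mass at least `w x`, and some final cell has
mean `y` and mass at least `w y`; keeping the more valuable of the two loses at most half
(`IsPooling.half_of_pair`).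

Attainment. The joint laws of state and signal with the given state marginal form a compact set on
which the value is upper semicontinuous. The pairs of a partition and a law respecting it are
compact as well.

Upper bound. Let almost all mass sit, symmetrically, near `0` and `1`, and let `u` pay only at the
means `δ` and `1 - δ`. Randomization produces both means with total probability one. A cell with
mean `δ` and more than negligible mass must stretch from near `0` to near `1`, and so must one with
mean `1 - δ`; ordered cells cannot both do so. Hence a partition profits from only one of the means,
with probability about one half (`IsNearlyExtreme.expectedUtility_le`). -/

namespace InfoDesign

/-! ### Mass and moment functions; concatenating partitions -/

/-- The two functions behave like `c ↦ F [0,c]` and `c ↦ ∫ θ in [0,c], θ ∂F` for an atomless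
measure `F` with full support on `[0,1]`. -/
structure IsMassMoment (Φ Ψ : ℝ → ℝ) : Prop where
  continuousOn : ContinuousOn Φ (Set.Icc 0 1)
  lower : ∀ s t, 0 ≤ s → s < t → t ≤ 1 → s * (Φ t - Φ s) < Ψ t - Ψ s
  upper : ∀ s t, 0 ≤ s → s < t → t ≤ 1 → Ψ t - Ψ s < t * (Φ t - Φ s)

/-- The weighted sum of put payoffs with strike `c`. -/
noncomputable def putSum (S : Finset ℝ) (w : ℝ → ℝ) (c : ℝ) : ℝ := ∑ x ∈ S, w x * max (c - x) 0

/-- The integral of the put payoff with strike `c` over `[a,c]`. -/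
noncomputable def putIntegral (Φ Ψ : ℝ → ℝ) (a c : ℝ) : ℝ := c * (Φ c - Φ a) - (Ψ c - Ψ a)

/-- The value `v` of the mean of the cell `[s,t]`, weighted by the mass of the cell. -/
noncomputable def cellValue (Φ Ψ v : ℝ → ℝ) (s t : ℝ) : ℝ := (Φ t - Φ s) * v ((Ψ t - Ψ s) / (Φ t - Φ s))

/-- Some partition of `[a,b]` into `n` cells has a total value of at least `r`. -/
def PartitionAttains (V : ℝ → ℝ → ℝ) (n : ℕ) (a b r : ℝ) : Prop :=
  ∃ t : ℕ → ℝ, Monotone t ∧ t 0 = a ∧ t n = b ∧ r ≤ ∑ j ∈ Finset.range n, V (t j) (t (j + 1))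

namespace PartitionAttains

variable {V : ℝ → ℝ → ℝ} {n m : ℕ} {a b c r s : ℝ}

theorem mono (h : PartitionAttains V n a b r) (hs : s ≤ r) : PartitionAttains V n a b s := by
  obtain ⟨t, h1, h2, h3, h4⟩ := h
  exact ⟨t, h1, h2, h3, hs.trans h4⟩

theorem single (hab : a ≤ b) : PartitionAttains V 1 a b (V a b) := by
  refine ⟨fun j => if j = 0 then a else b, ?_, by simp, by simp, by simp⟩
  intro i j hij
  by_cases hj : j = 0
  · have : i = 0 := by omega
    simp [hj, this]
  · by_cases hi : i = 0 <;> simp [hi, hj, hab]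

theorem append (h₁ : PartitionAttains V n a b r) (h₂ : PartitionAttains V m b c s) :
    PartitionAttains V (n + m) a c (r + s) := by
  obtain ⟨t₁, m₁, z₁, e₁, s₁⟩ := h₁
  obtain ⟨t₂, m₂, z₂, e₂, s₂⟩ := h₂
  refine ⟨fun j => if j ≤ n then t₁ j else t₂ (j - n), ?_, by simp [z₁], ?_, ?_⟩
  · intro i j hij
    by_cases hj : j ≤ n
    · have : i ≤ n := hij.trans hj
      simpa [hj, this] using m₁ hij
    · by_cases hi : i ≤ n
      · simp only [hi, hj, if_true, if_false]
        calc t₁ i ≤ t₁ n := m₁ hi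
          _ = t₂ 0 := by rw [e₁, z₂]
          _ ≤ _ := m₂ (Nat.zero_le _)
      · simp only [hi, hj, if_false]
        exact m₂ (Nat.sub_le_sub_right hij n)
  · by_cases hm : m = 0
    · subst hm
      simp [e₁, ← e₂, z₂]
    · have : ¬ n + m ≤ n := by omega
      simp [hm, e₂]
  · rw [Finset.sum_range_add]
    refine add_le_add (s₁.trans (Finset.sum_le_sum fun j hj => ?_))
      (s₂.trans (Finset.sum_le_sum fun j hj => ?_))
    · have hj := Finset.mem_range.1 hj
      have h1 : j ≤ n := hj.le
      have h2 : j + 1 ≤ n := hj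
      simp [h1, h2]
    · have h2 : ¬ n + j + 1 ≤ n := by omega
      have h3 : n + j + 1 - n = j + 1 := by omega
      by_cases h0 : j = 0
      · subst h0
        simp [e₁, z₂]
      · simp [h0, h2, h3]

/-- Degenerate cells are worth nothing, so a bound obtained with few cells persists when more are
allowed. -/
theorem pad (h : PartitionAttains V n a b r) (hV : ∀ x, V x x = 0) (hnm : n ≤ m) :
    PartitionAttains V m a b r := by
  obtain ⟨k, rfl⟩ := Nat.exists_eq_add_of_le hnm
  induction k with
  | zero => exact h
  | succ k ih =>
    have := (ih (by omega)).append (single (V := V) (le_refl b))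
    rwa [hV, add_zero] at this

end PartitionAttains

/-! ### Poolings and the cells that realize a single mean -/

section Core

variable {Φ Ψ v : ℝ → ℝ} {a b : ℝ} {S : Finset ℝ} {w : ℝ → ℝ}

namespace IsMassMoment

theorem lt (h : IsMassMoment Φ Ψ) {s t : ℝ} (hs : 0 ≤ s) (hst : s < t) (ht : t ≤ 1) : Φ s < Φ t := by
  have h1 := h.lower s t hs hst ht
  have h2 := h.upper s t hs hst ht
  nlinarith

/-- States lie in `[0,1]`, so an increment of the moment is dominated by the increment of the mass.
-/
theorem continuousOn_moment (h : IsMassMoment Φ Ψ) : ContinuousOn Ψ (Set.Icc 0 1) := by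
  have key : ∀ s t, 0 ≤ s → s ≤ t → t ≤ 1 → |Ψ t - Ψ s| ≤ |Φ t - Φ s| := by
    intro s t hs hst ht
    rcases hst.eq_or_lt with rfl | hst
    · simp
    have h1 := h.lower s t hs hst ht
    have h2 := h.upper s t hs hst ht
    have h3 := h.lt hs hst ht
    rw [abs_of_nonneg (by nlinarith), abs_of_nonneg (by linarith)]
    nlinarith
  have key' : ∀ s ∈ Set.Icc (0 : ℝ) 1, ∀ t ∈ Set.Icc (0 : ℝ) 1, |Ψ t - Ψ s| ≤ |Φ t - Φ s| := by
    intro s hs t ht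
    rcases le_total s t with hst | hst
    · exact key s t hs.1 hst ht.2
    · rw [abs_sub_comm (Ψ t), abs_sub_comm (Φ t)]
      exact key t s ht.1 hst hs.2
  have hc := h.continuousOn
  rw [Metric.continuousOn_iff] at hc ⊢
  intro s hs ε hε
  obtain ⟨δ, hδ, hd⟩ := hc s hs ε hε
  exact ⟨δ, hδ, fun t ht htd => (key' s hs t ht).trans_lt (hd t ht htd)⟩

theorem cellValue_nonneg (h : IsMassMoment Φ Ψ) (hv : ∀ x, 0 ≤ v x) {s t : ℝ} (hs : 0 ≤ s)
    (hst : s ≤ t) (ht : t ≤ 1) : 0 ≤ cellValue Φ Ψ v s t := by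
  refine mul_nonneg ?_ (hv _)
  rcases hst.eq_or_lt with rfl | hst
  · simp
  · linarith [h.lt hs hst ht]

end IsMassMoment

/-- Necessary conditions for the weights `w` on the means in `S` to come from pooling the mass on
`[a,b]`: equal mass, equal moment, and the put inequalities of the convex order. -/
structure IsPooling (Φ Ψ : ℝ → ℝ) (a b : ℝ) (S : Finset ℝ) (w : ℝ → ℝ) : Prop where
  nonneg : ∀ x ∈ S, 0 ≤ w x
  mass : ∑ x ∈ S, w x = Φ b - Φ a
  moment : ∑ x ∈ S, w x * x = Ψ b - Ψ a
  put : ∀ c ∈ Set.Icc a b, putSum S w c ≤ putIntegral Φ Ψ a c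

namespace IsPooling

theorem put_single_le (h : IsPooling Φ Ψ a b S w) {x c : ℝ} (hx : x ∈ S) (hc : c ∈ Set.Icc a b) :
    w x * (c - x) ≤ putIntegral Φ Ψ a c := by
  refine le_trans ?_ (h.put c hc)
  refine le_trans (mul_le_mul_of_nonneg_left (le_max_left _ 0) (h.nonneg x hx)) ?_
  exact Finset.single_le_sum (f := fun x => w x * max (c - x) 0)
    (fun y hy => mul_nonneg (h.nonneg y hy) (le_max_right _ _)) hx

/-- Put-call parity: since mass and moment agree on `[a,b]`, the put inequality at `c` is equivalent
to the call inequality. This makes the arguments at the right end mirror those at the left. -/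
theorem call_single_le (h : IsPooling Φ Ψ a b S w) {x c : ℝ} (hx : x ∈ S) (hc : c ∈ Set.Icc a b) :
    w x * (x - c) ≤ (Ψ b - Ψ c) - c * (Φ b - Φ c) := by
  have h1 : w x * (x - c) ≤ ∑ y ∈ S, w y * max (y - c) 0 := by
    refine le_trans (mul_le_mul_of_nonneg_left (le_max_left _ 0) (h.nonneg x hx)) ?_
    exact Finset.single_le_sum (f := fun x => w x * max (x - c) 0)
      (fun y hy => mul_nonneg (h.nonneg y hy) (le_max_right _ _)) hx
  have h2 : ∑ y ∈ S, w y * max (y - c) 0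
      = ∑ y ∈ S, w y * y - c * ∑ y ∈ S, w y + putSum S w c := by
    rw [Finset.mul_sum, ← Finset.sum_sub_distrib, putSum, ← Finset.sum_add_distrib]
    refine Finset.sum_congr rfl fun y _ => ?_
    have : max (y - c) 0 = (y - c) + max (c - y) 0 := by
      rcases le_total y c with h | h
      · rw [max_eq_right (by linarith), max_eq_left (by linarith)]; ring
      · rw [max_eq_left (by linarith), max_eq_right (by linarith)]; ring
    rw [this]; ring
  have h3 := h.put c hc
  rw [h.mass, h.moment] at h2
  unfold putIntegral at h3
  linarith

/-- An atom at or below `a` has put payoff at least `w x * (c - a)`, while the put integral is at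
most `(Φ c - Φ a) * (c - a)`. Letting `c` decrease to `a` forces `w x ≤ 0`, because `Φ` has no jump.
-/
theorem lt_of_mem (h : IsPooling Φ Ψ a b S w) (hF : IsMassMoment Φ Ψ) (ha : 0 ≤ a) (hab : a < b)
    (hb : b ≤ 1) {x : ℝ} (hx : x ∈ S) (hw : 0 < w x) : a < x := by
  by_contra! hxa
  have hcont : ContinuousWithinAt Φ (Set.Ioo a b) a :=
    (hF.continuousOn a ⟨ha, by linarith⟩).mono fun c hc => ⟨ha.trans hc.1.le, hc.2.le.trans hb⟩
  have hne : (nhdsWithin a (Set.Ioo a b)).NeBot := by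
    rw [nhdsWithin_Ioo_eq_nhdsGT hab]; infer_instance
  have hle : w x ≤ Φ a - Φ a := by
    refine ge_of_tendsto (hcont.sub_const (Φ a)) ?_
    filter_upwards [self_mem_nhdsWithin] with c hc
    have h1 := h.put_single_le hx ⟨hc.1.le, hc.2.le⟩
    have h2 := hF.lower a c ha hc.1 (hc.2.le.trans hb)
    unfold putIntegral at h1
    have h3 : w x * (c - a) ≤ (Φ c - Φ a) * (c - a) := by nlinarith
    exact le_of_mul_le_mul_right h3 (by linarith [hc.1])
  linarith

theorem mem_lt (h : IsPooling Φ Ψ a b S w) (hF : IsMassMoment Φ Ψ) (ha : 0 ≤ a) (hab : a < b)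
    (hb : b ≤ 1) {x : ℝ} (hx : x ∈ S) (hw : 0 < w x) : x < b := by
  by_contra! hxa
  have hcont : ContinuousWithinAt Φ (Set.Ioo a b) b :=
    (hF.continuousOn b ⟨by linarith, hb⟩).mono fun c hc => ⟨ha.trans hc.1.le, hc.2.le.trans hb⟩
  have hne : (nhdsWithin b (Set.Ioo a b)).NeBot := by
    rw [nhdsWithin_Ioo_eq_nhdsLT hab]; infer_instance
  have hle : w x ≤ Φ b - Φ b := by
    refine ge_of_tendsto (hcont.const_sub (Φ b)) ?_
    filter_upwards [self_mem_nhdsWithin] with c hc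
    have h1 := h.call_single_le hx ⟨hc.1.le, hc.2.le⟩
    have h2 := hF.upper c b (ha.trans hc.1.le) hc.2 hb
    have h3 : w x * (b - c) ≤ (Φ b - Φ c) * (b - c) := by nlinarith
    exact le_of_mul_le_mul_right h3 (by linarith [hc.2])
  linarith

/-- Some initial cell of `[a,b]` has mean `x` and mass at least `w x`, if `x` is below the mean. -/
theorem exists_left_cell (h : IsPooling Φ Ψ a b S w) (hF : IsMassMoment Φ Ψ) (ha : 0 ≤ a)
    (hab : a < b) (hb : b ≤ 1) {x : ℝ} (hx : x ∈ S) (hw : 0 < w x)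
    (hmean : x * (Φ b - Φ a) ≤ Ψ b - Ψ a) :
    ∃ c ∈ Set.Icc a b, ∀ v : ℝ → ℝ, (∀ x, 0 ≤ v x) → w x * v x ≤ cellValue Φ Ψ v a c := by
  have hax := h.lt_of_mem hF ha hab hb hx hw
  have hxb := h.mem_lt hF ha hab hb hx hw
  have hsub : Set.Icc x b ⊆ Set.Icc 0 1 := fun c hc => ⟨by linarith [hc.1], hc.2.trans hb⟩
  have hcont : ContinuousOn (fun c => x * (Φ c - Φ a) - (Ψ c - Ψ a)) (Set.Icc x b) :=
    (continuousOn_const.mul ((hF.continuousOn.mono hsub).sub continuousOn_const)).sub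
      ((hF.continuousOn_moment.mono hsub).sub continuousOn_const)
  have hu := hF.upper a x ha hax (by linarith)
  -- The cell `[a,x]` has mean below `x` and `[a,b]` has mean at least `x`; an intermediate `[a,c]`
  -- has mean exactly `x`.
  obtain ⟨c, hc, hc0⟩ : (0 : ℝ) ∈ (fun c => x * (Φ c - Φ a) - (Ψ c - Ψ a)) '' Set.Icc x b :=
    intermediate_value_Icc' hxb.le hcont ⟨by linarith, by linarith⟩
  have hxc : x < c := by
    refine lt_of_le_of_ne hc.1 fun hxc => ?_
    subst hxc
    simp only at hc0
    linarith
  have hcI : c ∈ Set.Icc a b := ⟨by linarith, hc.2⟩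
  refine ⟨c, hcI, fun v hv => ?_⟩
  have hm := hF.lt ha (hax.trans hxc) (hc.2.trans hb)
  have h1 := h.put_single_le hx hcI
  simp only at hc0
  -- As `[a,c]` has mean `x`, its put integral at strike `c` is `(c - x)` times its mass, so the put
  -- inequality for the single atom `x` compares the masses.
  have h2 : w x ≤ Φ c - Φ a := by
    unfold putIntegral at h1
    have : w x * (c - x) ≤ (Φ c - Φ a) * (c - x) := by linarith
    exact le_of_mul_le_mul_right this (by linarith)
  have h3 : (Ψ c - Ψ a) / (Φ c - Φ a) = x := by
    rw [div_eq_iff (by linarith)]; linarith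
  rw [cellValue, h3]
  exact mul_le_mul_of_nonneg_right h2 (hv x)

/-- Some final cell of `[a,b]` has mean `x` and mass at least `w x`, if `x` is above the mean. -/
theorem exists_right_cell (h : IsPooling Φ Ψ a b S w) (hF : IsMassMoment Φ Ψ) (ha : 0 ≤ a)
    (hab : a < b) (hb : b ≤ 1) {x : ℝ} (hx : x ∈ S) (hw : 0 < w x)
    (hmean : Ψ b - Ψ a ≤ x * (Φ b - Φ a)) :
    ∃ c ∈ Set.Icc a b, ∀ v : ℝ → ℝ, (∀ x, 0 ≤ v x) → w x * v x ≤ cellValue Φ Ψ v c b := by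
  have hax := h.lt_of_mem hF ha hab hb hx hw
  have hxb := h.mem_lt hF ha hab hb hx hw
  have hsub : Set.Icc a x ⊆ Set.Icc 0 1 := fun c hc => ⟨by linarith [hc.1], by linarith [hc.2]⟩
  have hcont : ContinuousOn (fun c => x * (Φ b - Φ c) - (Ψ b - Ψ c)) (Set.Icc a x) :=
    (continuousOn_const.mul (continuousOn_const.sub (hF.continuousOn.mono hsub))).sub
      (continuousOn_const.sub (hF.continuousOn_moment.mono hsub))
  have hu := hF.lower x b (by linarith) hxb hb
  obtain ⟨c, hc, hc0⟩ : (0 : ℝ) ∈ (fun c => x * (Φ b - Φ c) - (Ψ b - Ψ c)) '' Set.Icc a x :=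
    intermediate_value_Icc' hax.le hcont ⟨by linarith, by linarith⟩
  have hxc : c < x := by
    refine lt_of_le_of_ne hc.2 fun hxc => ?_
    subst hxc
    simp only at hc0
    linarith
  have hcI : c ∈ Set.Icc a b := ⟨hc.1, by linarith⟩
  refine ⟨c, hcI, fun v hv => ?_⟩
  have hm := hF.lt (ha.trans hc.1) (hxc.trans hxb) hb
  have h1 := h.call_single_le hx hcI
  simp only at hc0
  have h2 : w x ≤ Φ b - Φ c := by
    have : w x * (x - c) ≤ (Φ b - Φ c) * (x - c) := by linarith
    exact le_of_mul_le_mul_right this (by linarith)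
  have h3 : (Ψ b - Ψ c) / (Φ b - Φ c) = x := by
    rw [div_eq_iff (by linarith)]; linarith
  rw [cellValue, h3]
  exact mul_le_mul_of_nonneg_right h2 (hv x)

end IsPooling

end Core

/-! ### Splitting at tight strikes, extremal weights, and the induction -/

section Core

variable {Φ Ψ v : ℝ → ℝ} {a b : ℝ} {S : Finset ℝ} {w : ℝ → ℝ}

theorem IsPooling.filter_pos (h : IsPooling Φ Ψ a b S w) :
    IsPooling Φ Ψ a b (S.filter fun x => w x ≠ 0) w := by
  have key : ∀ f : ℝ → ℝ, ∑ x ∈ S.filter (fun x => w x ≠ 0), w x * f x = ∑ x ∈ S, w x * f x := by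
    intro f
    refine Finset.sum_filter_of_ne fun x _ hx hw => hx ?_
    rw [hw, zero_mul]
  refine ⟨fun x hx => h.nonneg x (Finset.mem_filter.1 hx).1, ?_, ?_, fun c hc => ?_⟩
  · simpa using (key fun _ => 1).trans (by simpa using h.mass)
  · exact (key fun x => x).trans h.moment
  · exact (key fun x => max (c - x) 0).trans_le (h.put c hc)

/-- With the companion bound below: the put integral has slope `Φ - Φ a` in the strike, expressed
through difference quotients. -/
theorem putIntegral_sub_le (hF : IsMassMoment Φ Ψ) {s t : ℝ} (hs : 0 ≤ s) (hst : s < t)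
    (ht : t ≤ 1) : putIntegral Φ Ψ a t - putIntegral Φ Ψ a s ≤ (t - s) * (Φ t - Φ a) := by
  have := hF.lower s t hs hst ht
  unfold putIntegral
  linarith

theorem le_putIntegral_sub (hF : IsMassMoment Φ Ψ) {s t : ℝ} (hs : 0 ≤ s) (hst : s < t)
    (ht : t ≤ 1) : (t - s) * (Φ s - Φ a) ≤ putIntegral Φ Ψ a t - putIntegral Φ Ψ a s := by
  have := hF.upper s t hs hst ht
  unfold putIntegral
  linarith

/-- At a strike where the put inequality is tight, the pooling splits into two. -/
theorem IsPooling.split (h : IsPooling Φ Ψ a b S w) (hF : IsMassMoment Φ Ψ) (ha : 0 ≤ a)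
    (hb : b ≤ 1) {c : ℝ} (hc : c ∈ Set.Ioo a b) (hcp : putSum S w c = putIntegral Φ Ψ a c) :
    IsPooling Φ Ψ a c (S.filter (· < c)) w ∧ IsPooling Φ Ψ c b (S.filter fun x => ¬ x < c) w := by
  have hcont : ∀ s ⊆ Set.Ioo a b, ContinuousWithinAt Φ s c := fun s hs =>
    (hF.continuousOn c ⟨by linarith [hc.1], by linarith [hc.2]⟩).mono fun c hc =>
      ⟨ha.trans (hs hc).1.le, (hs hc).2.le.trans hb⟩
  -- The gap `putIntegral - putSum` is nonnegative and vanishes at `c`. Its difference quotients to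
  -- the right are nonnegative, which bounds the atoms up to `c` from above.
  have hright : ∑ x ∈ S.filter (· ≤ c), w x ≤ Φ c - Φ a := by
    have hne : (nhdsWithin c (Set.Ioo c b)).NeBot := by
      rw [nhdsWithin_Ioo_eq_nhdsGT hc.2]; infer_instance
    refine ge_of_tendsto
      ((hcont (Set.Ioo c b) (Set.Ioo_subset_Ioo_left hc.1.le)).sub_const (Φ a)) ?_
    filter_upwards [self_mem_nhdsWithin] with t ht
    have h1 := h.put t ⟨by linarith [hc.1, ht.1], ht.2.le⟩
    have h2 := putIntegral_sub_le (a := a) hF (by linarith [hc.1]) ht.1 (ht.2.le.trans hb)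
    have h3 : (t - c) * ∑ x ∈ S.filter (· ≤ c), w x ≤ putSum S w t - putSum S w c := by
      rw [putSum, putSum, ← Finset.sum_sub_distrib, Finset.mul_sum, Finset.sum_filter]
      refine Finset.sum_le_sum fun x hx => ?_
      have hw := h.nonneg x hx
      split_ifs with hxc
      · have := ht.1
        rw [max_eq_left (by linarith), max_eq_left (by linarith)]
        linarith
      · rw [max_eq_right (a := c - x) (by linarith)]
        nlinarith [le_max_right (t - x) 0]
    have h4 : (t - c) * ∑ x ∈ S.filter (· ≤ c), w x ≤ (t - c) * (Φ t - Φ a) := by linarith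
    exact le_of_mul_le_mul_left h4 (by linarith [ht.1])
  -- The quotients to the left bound the atoms strictly below `c` from below. The two bounds pinch:
  -- an atom at `c` carries no weight.
  have hleft : Φ c - Φ a ≤ ∑ x ∈ S.filter (· < c), w x := by
    have hne : (nhdsWithin c (Set.Ioo a c)).NeBot := by
      rw [nhdsWithin_Ioo_eq_nhdsLT hc.1]; infer_instance
    refine le_of_tendsto
      ((hcont (Set.Ioo a c) (Set.Ioo_subset_Ioo_right hc.2.le)).sub_const (Φ a)) ?_
    filter_upwards [self_mem_nhdsWithin] with t ht
    have h1 := h.put t ⟨ht.1.le, by linarith [hc.2, ht.2]⟩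
    have h2 := le_putIntegral_sub (a := a) hF (by linarith [ht.1]) ht.2 (hc.2.le.trans hb)
    have h3 : putSum S w c - putSum S w t ≤ (c - t) * ∑ x ∈ S.filter (· < c), w x := by
      rw [putSum, putSum, ← Finset.sum_sub_distrib, Finset.mul_sum, Finset.sum_filter]
      refine Finset.sum_le_sum fun x hx => ?_
      have hw := h.nonneg x hx
      split_ifs with hxc
      · rw [max_eq_left (a := c - x) (by linarith)]
        nlinarith [le_max_left (t - x) 0]
      · rw [max_eq_right (a := c - x) (by linarith)]
        nlinarith [le_max_right (t - x) 0]
    have h4 : (c - t) * (Φ t - Φ a) ≤ (c - t) * ∑ x ∈ S.filter (· < c), w x := by linarith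
    exact le_of_mul_le_mul_left h4 (by linarith [ht.2])
  have hsub : S.filter (· < c) ⊆ S.filter (· ≤ c) :=
    Finset.monotone_filter_right S fun x _ hx => le_of_lt hx
  have hmass : ∑ x ∈ S.filter (· < c), w x = Φ c - Φ a := by
    refine le_antisymm (le_trans ?_ hright) hleft
    exact Finset.sum_le_sum_of_subset_of_nonneg hsub
      fun x hx _ => h.nonneg x (Finset.mem_filter.1 hx).1
  have hput : ∀ t, c ≤ t → putSum (S.filter (· < c)) w t
      = t * ∑ x ∈ S.filter (· < c), w x - ∑ x ∈ S.filter (· < c), w x * x := by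
    intro t ht
    rw [putSum, Finset.mul_sum, ← Finset.sum_sub_distrib]
    refine Finset.sum_congr rfl fun x hx => ?_
    have := (Finset.mem_filter.1 hx).2
    rw [max_eq_left (by linarith)]; ring
  have hput' : ∀ t, putSum (S.filter (· < c)) w t + putSum (S.filter fun x => ¬ x < c) w t
      = putSum S w t := fun t => Finset.sum_filter_add_sum_filter_not S _ _
  have hnn : ∀ t, ∀ x ∈ S, 0 ≤ w x * max (t - x) 0 :=
    fun t x hx => mul_nonneg (h.nonneg x hx) (le_max_right _ _)
  -- At strike `c` only the atoms below `c` pay, so tightness there, combined with equal mass, is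
  -- equality of moments.
  have hmoment : ∑ x ∈ S.filter (· < c), w x * x = Ψ c - Ψ a := by
    have h0 : putSum (S.filter fun x => ¬ x < c) w c = 0 := by
      refine Finset.sum_eq_zero fun x hx => ?_
      have := (Finset.mem_filter.1 hx).2
      rw [max_eq_right (by linarith), mul_zero]
    have h1 := hput c le_rfl
    have h2 := hput' c
    rw [hmass] at h1
    unfold putIntegral at hcp
    linarith
  have hm1 := Finset.sum_filter_add_sum_filter_not S (· < c) w
  have hm2 := Finset.sum_filter_add_sum_filter_not S (· < c) fun x => w x * x
  refine ⟨⟨fun x hx => h.nonneg x (Finset.mem_filter.1 hx).1, hmass, hmoment, fun t ht => ?_⟩,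
    ⟨fun x hx => h.nonneg x (Finset.mem_filter.1 hx).1, ?_, ?_, fun t ht => ?_⟩⟩
  · refine le_trans ?_ (h.put t ⟨ht.1, ht.2.trans hc.2.le⟩)
    exact Finset.sum_le_sum_of_subset_of_nonneg (Finset.filter_subset _ _) fun x hx _ => hnn t x hx
  · linarith [h.mass]
  · linarith [h.moment]
  -- Beyond `c` the put sum of the left atoms is affine in the strike and equals the put integral of
  -- the states in `[a,c]`; subtracting it leaves the inequality for `[c,b]`.
  · have h1 := hput t ht.1
    have h2 := hput' t
    have h3 := h.put t ⟨hc.1.le.trans ht.1, ht.2⟩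
    rw [hmass, hmoment] at h1
    unfold putIntegral at h3 ⊢
    linarith

/-- A nonzero direction in which the weights can move without changing mass and moment, and
without decreasing a given linear functional. -/
theorem exists_direction (v : ℝ → ℝ) (hS : 2 < S.card) :
    ∃ δ : ℝ → ℝ, ∑ x ∈ S, δ x = 0 ∧ ∑ x ∈ S, δ x * x = 0 ∧ 0 ≤ ∑ x ∈ S, δ x * v x ∧
      ∃ x ∈ S, δ x ≠ 0 := by
  obtain ⟨x, hx, y, hy, z, hz, hxy, hxz, hyz⟩ := Finset.two_lt_card.1 hS
  -- The coefficients `z - y`, `x - z`, `y - x` on three atoms annihilate both constants and the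
  -- identity; the sign of `k` is free to make the functional nonnegative.
  have key : ∀ k : ℝ, ∃ δ : ℝ → ℝ, (∀ f : ℝ → ℝ, ∑ t ∈ S, δ t * f t
      = k * ((z - y) * f x + (x - z) * f y + (y - x) * f z)) ∧ δ x = k * (z - y) := by
    intro k
    refine ⟨fun t => k * ((if t = x then z - y else 0) + (if t = y then x - z else 0)
      + (if t = z then y - x else 0)), fun f => ?_, ?_⟩
    · simp only [mul_assoc, ← Finset.mul_sum, add_mul, ite_mul, zero_mul, Finset.sum_add_distrib,
        Finset.sum_ite_eq', hx, hy, hz, if_true]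
    · simp [hxy, hxz]
  have hne : z - y ≠ 0 := sub_ne_zero.2 hyz.symm
  have fin : ∀ k : ℝ, k ≠ 0 → 0 ≤ k * ((z - y) * v x + (x - z) * v y + (y - x) * v z) →
      ∃ δ : ℝ → ℝ, ∑ x ∈ S, δ x = 0 ∧ ∑ x ∈ S, δ x * x = 0 ∧ 0 ≤ ∑ x ∈ S, δ x * v x ∧
        ∃ x ∈ S, δ x ≠ 0 := by
    intro k hk hk0
    obtain ⟨δ, hδ, hδx⟩ := key k
    refine ⟨δ, ?_, ?_, (hδ v).symm ▸ hk0, x, hx, hδx ▸ mul_ne_zero hk hne⟩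
    · have := hδ fun _ => 1
      simp only [mul_one] at this
      rw [this]; ring
    · rw [hδ fun t => t]; ring
  rcases le_total 0 ((z - y) * v x + (x - z) * v y + (y - x) * v z) with h | h
  · exact fin 1 one_ne_zero (by linarith)
  · exact fin (-1) (by norm_num) (by linarith)

theorem putSum_add_mul (δ : ℝ → ℝ) (t c : ℝ) :
    putSum S (fun x => w x + t * δ x) c = putSum S w c + t * putSum S δ c := by
  rw [putSum, putSum, putSum, Finset.mul_sum, ← Finset.sum_add_distrib]
  exact Finset.sum_congr rfl fun x _ => by ring

theorem continuous_putSum (δ : ℝ → ℝ) : Continuous (putSum S δ) := by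
  unfold putSum
  fun_prop

/-- Moving the weights as far as possible in a balanced direction kills a weight or makes a put
inequality tight. -/
theorem IsPooling.exists_extremal (h : IsPooling Φ Ψ a b S w) (hF : IsMassMoment Φ Ψ) (ha : 0 ≤ a)
    (hab : a < b) (hb : b ≤ 1) {δ : ℝ → ℝ} (h0 : ∑ x ∈ S, δ x = 0) (h1 : ∑ x ∈ S, δ x * x = 0)
    (hne : ∃ x ∈ S, δ x ≠ 0) :
    ∃ t : ℝ, 0 ≤ t ∧ IsPooling Φ Ψ a b S (fun x => w x + t * δ x) ∧
      ((∃ x ∈ S, w x + t * δ x = 0) ∨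
        ∃ c ∈ Set.Ioo a b, putSum S (fun x => w x + t * δ x) c = putIntegral Φ Ψ a c) := by
  have hpool : ∀ t, (∀ x ∈ S, 0 ≤ w x + t * δ x) →
      (∀ c ∈ Set.Icc a b, putSum S w c + t * putSum S δ c ≤ putIntegral Φ Ψ a c) →
      IsPooling Φ Ψ a b S (fun x => w x + t * δ x) := by
    intro t ht1 ht2
    refine ⟨ht1, ?_, ?_, fun c hc => (putSum_add_mul δ t c).trans_le (ht2 c hc)⟩
    · rw [Finset.sum_add_distrib, ← Finset.mul_sum, h0, h.mass]; ring
    · simp only [add_mul, mul_assoc]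
      rw [Finset.sum_add_distrib, ← Finset.mul_sum, h1, h.moment]; ring
  -- The feasible step sizes. Since `δ` sums to zero without vanishing on `S`, some weight
  -- decreases, so this set is compact and has a largest element.
  let T : Set ℝ := {t | 0 ≤ t ∧ (∀ x ∈ S, 0 ≤ w x + t * δ x) ∧
      ∀ c ∈ Set.Icc a b, putSum S w c + t * putSum S δ c ≤ putIntegral Φ Ψ a c}
  obtain ⟨x₀, hx₀, hδ₀⟩ : ∃ x ∈ S, δ x < 0 := by
    by_contra! hpos
    obtain ⟨x, hx, hx0⟩ := hne
    exact hx0 ((Finset.sum_eq_zero_iff_of_nonneg hpos).1 h0 x hx)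
  have hTclosed : IsClosed T := by
    have hT : T = Set.Ici 0 ∩ ((⋂ x ∈ S, {t | 0 ≤ w x + t * δ x}) ∩
        ⋂ c ∈ Set.Icc a b, {t | putSum S w c + t * putSum S δ c ≤ putIntegral Φ Ψ a c}) := by
      ext t
      simp only [T, Set.mem_inter_iff, Set.mem_iInter, Set.mem_Ici]
      rfl
    rw [hT]
    refine isClosed_Ici.inter (IsClosed.inter ?_ ?_)
    · exact isClosed_biInter fun x _ => isClosed_le (by fun_prop) (by fun_prop)
    · exact isClosed_biInter fun c _ => isClosed_le (by fun_prop) (by fun_prop)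
  have hTsub : T ⊆ Set.Icc 0 (w x₀ / (-δ x₀)) := fun t ht => ⟨ht.1, by
    rw [le_div_iff₀ (by linarith)]
    linarith [ht.2.1 x₀ hx₀]⟩
  have hTcompact : IsCompact T := isCompact_Icc.of_isClosed_subset hTclosed hTsub
  have hT0 : (0 : ℝ) ∈ T := ⟨le_rfl, fun x hx => by simpa using h.nonneg x hx,
    fun c hc => by simpa using h.put c hc⟩
  obtain ⟨t, htT, htmax⟩ := hTcompact.exists_isGreatest ⟨0, hT0⟩
  have hP := hpool t htT.2.1 htT.2.2
  refine ⟨t, htT.1, hP, ?_⟩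
  by_contra! hcon
  obtain ⟨hw0, hc0⟩ := hcon
  have hwpos : ∀ x ∈ S, 0 < w x + t * δ x :=
    fun x hx => lt_of_le_of_ne (htT.2.1 x hx) (hw0 x hx).symm
  have hSne : S.Nonempty := ⟨x₀, hx₀⟩
  set p := S.min' hSne
  set q := S.max' hSne
  have hap : a < p := hP.lt_of_mem hF ha hab hb (S.min'_mem hSne) (hwpos _ (S.min'_mem hSne))
  have hqb : q < b := hP.mem_lt hF ha hab hb (S.max'_mem hSne) (hwpos _ (S.max'_mem hSne))
  have hpq : p ≤ q := S.min'_le_max' hSne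
  -- A balanced direction leaves the put sum unchanged below all atoms and above all atoms. Only
  -- strikes in `[p,q]`, a compact part of the open interval `(a,b)`, can become binding.
  have hout : ∀ c, c ∉ Set.Icc p q → putSum S δ c = 0 := by
    intro c hc
    rcases lt_or_ge c p with hcp | hcp
    · refine Finset.sum_eq_zero fun x hx => ?_
      have := S.min'_le x hx
      rw [max_eq_right (by linarith), mul_zero]
    · have hcq : q < c := by
        by_contra! hcq
        exact hc ⟨hcp, hcq⟩
      have : putSum S δ c = c * ∑ x ∈ S, δ x - ∑ x ∈ S, δ x * x := by
        rw [putSum, Finset.mul_sum, ← Finset.sum_sub_distrib]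
        refine Finset.sum_congr rfl fun x hx => ?_
        have := S.le_max' x hx
        rw [max_eq_left (by linarith)]; ring
      rw [this, h0, h1]; ring
  have hsub : Set.Icc p q ⊆ Set.Icc 0 1 := fun c hc => ⟨by linarith [hc.1], by linarith [hc.2]⟩
  have hgap : ContinuousOn (fun c => putIntegral Φ Ψ a c - (putSum S w c + t * putSum S δ c))
      (Set.Icc p q) := by
    refine ContinuousOn.sub ?_ ((continuous_putSum w).add
      (continuous_const.mul (continuous_putSum δ))).continuousOn
    exact (continuousOn_id.mul ((hF.continuousOn.mono hsub).sub continuousOn_const)).sub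
      ((hF.continuousOn_moment.mono hsub).sub continuousOn_const)
  obtain ⟨c₁, hc₁, hmin⟩ := isCompact_Icc.exists_isMinOn ⟨p, le_rfl, hpq⟩ hgap
  obtain ⟨c₂, hc₂, hmax⟩ := isCompact_Icc.exists_isMaxOn ⟨p, le_rfl, hpq⟩
    (continuous_putSum (S := S) δ).continuousOn
  -- If nothing binds at the largest step, the slack on `[p,q]` is uniformly positive, so a slightly
  -- larger step is still feasible, a contradiction.
  set η := putIntegral Φ Ψ a c₁ - (putSum S w c₁ + t * putSum S δ c₁)
  have hη : 0 < η := by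
    have hc₁' : c₁ ∈ Set.Ioo a b := ⟨by linarith [hc₁.1], by linarith [hc₁.2]⟩
    have h2 := htT.2.2 c₁ ⟨hc₁'.1.le, hc₁'.2.le⟩
    have h3 := hc0 c₁ hc₁'
    rw [putSum_add_mul] at h3
    exact sub_pos.2 (lt_of_le_of_ne h2 h3)
  have hev : ∀ᶠ s in nhdsWithin t (Set.Ioi t), (∀ x ∈ S, 0 < w x + s * δ x) ∧
      (s - t) * putSum S δ c₂ < η := by
    refine Filter.Eventually.filter_mono nhdsWithin_le_nhds ?_
    refine Filter.Eventually.and ?_ ?_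
    · rw [Filter.eventually_all_finset]
      intro x hx
      have hx' : Continuous fun s => w x + s * δ x := by fun_prop
      exact hx'.continuousAt.eventually (lt_mem_nhds (hwpos x hx))
    · have hx' : Continuous fun s => (s - t) * putSum S δ c₂ := by fun_prop
      exact hx'.continuousAt.eventually (gt_mem_nhds (by simpa using hη))
  obtain ⟨s, ⟨hs1, hs2⟩, hst⟩ := (hev.and self_mem_nhdsWithin).exists
  have hst : t < s := hst
  have hsT : s ∈ T := by
    refine ⟨htT.1.trans hst.le, fun x hx => (hs1 x hx).le, fun c hc => ?_⟩
    have h2 := htT.2.2 c hc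
    by_cases hcpq : c ∈ Set.Icc p q
    · have h3 : η ≤ putIntegral Φ Ψ a c - (putSum S w c + t * putSum S δ c) := hmin hcpq
      have h4 : putSum S δ c ≤ putSum S δ c₂ := hmax hcpq
      nlinarith
    · rw [hout c hcpq] at h2 ⊢
      simpa using h2
  exact absurd (htmax hsT) (not_le.2 hst)

theorem cellValue_self (x : ℝ) : cellValue Φ Ψ v x x = 0 := by simp [cellValue]

/-- Two means: the better one of the two largest cells with these means is worth at least half. -/
theorem IsPooling.half_of_pair {x y : ℝ} (h : IsPooling Φ Ψ a b {x, y} w) (hF : IsMassMoment Φ Ψ)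
    (hv : ∀ x, 0 ≤ v x) (ha : 0 ≤ a) (hab : a < b) (hb : b ≤ 1) (hxy : x < y) (hx : 0 < w x)
    (hy : 0 < w y) :
    PartitionAttains (cellValue Φ Ψ v) 2 a b ((1 / 2) * (w x * v x + w y * v y)) := by
  have hm := h.mass
  have hmo := h.moment
  rw [Finset.sum_pair hxy.ne] at hm hmo
  have hcell : ∀ c ∈ Set.Icc a b, PartitionAttains (cellValue Φ Ψ v) 2 a b
      (cellValue Φ Ψ v a c + cellValue Φ Ψ v c b) :=
    fun c hc => (PartitionAttains.single hc.1).append (PartitionAttains.single hc.2)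
  -- The overall mean is an average of `x` and `y`, hence lies between them: this is the side
  -- condition of both cell lemmas.
  obtain ⟨c, hc, hcv⟩ := h.exists_left_cell hF ha hab hb (x := x) (by simp) hx
    (by rw [← hm, ← hmo]; nlinarith)
  obtain ⟨d, hd, hdv⟩ := h.exists_right_cell hF ha hab hb (x := y) (by simp) hy
    (by rw [← hm, ← hmo]; nlinarith)
  have h1 := hcv v hv
  have h2 := hdv v hv
  have h3 := hF.cellValue_nonneg hv (ha.trans hc.1) hc.2 hb
  have h4 := hF.cellValue_nonneg hv ha hd.1 (hd.2.trans hb)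
  rcases le_total (w x * v x) (w y * v y) with hle | hle
  · exact (hcell d hd).mono (by linarith)
  · exact (hcell c hc).mono (by linarith)

/-- A pooling with `n` means is worth at most twice as much as some partition into `n` cells. -/
theorem IsPooling.half_le_partition (hF : IsMassMoment Φ Ψ) (hv : ∀ x, 0 ≤ v x) :
    ∀ (n : ℕ) {a b : ℝ} {S : Finset ℝ} {w : ℝ → ℝ}, S.card = n → 0 ≤ a → a < b → b ≤ 1 →
      IsPooling Φ Ψ a b S w →
      PartitionAttains (cellValue Φ Ψ v) n a b ((1 / 2) * ∑ x ∈ S, w x * v x) := by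
  intro n
  induction n using Nat.strong_induction_on with
  | _ n ih =>
  intro a b S w hcard ha hab hb h
  by_cases hzero : ∃ x ∈ S, w x = 0
  · obtain ⟨x, hx, hwx⟩ := hzero
    have hlt : (S.filter fun x => w x ≠ 0).card < n := by
      rw [← hcard]
      refine Finset.card_lt_card (Finset.filter_ssubset.2 ⟨x, hx, by simpa using hwx⟩)
    have := (ih _ hlt rfl ha hab hb h.filter_pos).pad cellValue_self hlt.le
    rwa [Finset.sum_filter_of_ne] at this
    intro x _ hx hw
    exact hx (by rw [hw, zero_mul])
  push Not at hzero
  have hpos : ∀ x ∈ S, 0 < w x := fun x hx => lt_of_le_of_ne (h.nonneg x hx) (hzero x hx).symm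
  have hm := hF.lt ha hab hb
  rcases lt_or_ge 2 n with hn | hn
  · obtain ⟨δ, h0, h1, hδv, hne⟩ := exists_direction v (hcard.symm ▸ hn)
    obtain ⟨t, ht, hP, hcase⟩ := h.exists_extremal hF ha hab hb h0 h1 hne
    have hval : ∑ x ∈ S, w x * v x ≤ ∑ x ∈ S, (w x + t * δ x) * v x := by
      have : ∑ x ∈ S, (w x + t * δ x) * v x
          = ∑ x ∈ S, w x * v x + t * ∑ x ∈ S, δ x * v x := by
        rw [Finset.mul_sum, ← Finset.sum_add_distrib]
        exact Finset.sum_congr rfl fun x _ => by ring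
      rw [this]
      linarith [mul_nonneg ht hδv]
    refine PartitionAttains.mono (r := (1 / 2) * ∑ x ∈ S, (w x + t * δ x) * v x) ?_ (by linarith)
    rcases hcase with ⟨x, hx, hwx⟩ | ⟨c, hc, hcp⟩
    · have hlt : (S.filter fun x => w x + t * δ x ≠ 0).card < n := by
        rw [← hcard]
        refine Finset.card_lt_card (Finset.filter_ssubset.2 ⟨x, hx, by simpa using hwx⟩)
      have := (ih _ hlt rfl ha hab hb hP.filter_pos).pad cellValue_self hlt.le
      rwa [Finset.sum_filter_of_ne] at this
      intro x _ hx hw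
      exact hx (by rw [hw, zero_mul])
    -- Both halves have positive mass, hence at least one atom each, so each has fewer than `n`
    -- atoms, and the cells used add up to `n`.
    · obtain ⟨hL, hR⟩ := hP.split hF ha hb hc hcp
      have hLm := hF.lt ha hc.1 (hc.2.le.trans hb)
      have hRm := hF.lt (ha.trans hc.1.le) hc.2 hb
      have hLc : 0 < (S.filter (· < c)).card := by
        rw [Finset.card_pos, Finset.nonempty_iff_ne_empty]
        intro he
        have := hL.mass
        rw [he, Finset.sum_empty] at this
        linarith
      have hRc : 0 < (S.filter fun x => ¬ x < c).card := by
        rw [Finset.card_pos, Finset.nonempty_iff_ne_empty]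
        intro he
        have := hR.mass
        rw [he, Finset.sum_empty] at this
        linarith
      have hsum := Finset.card_filter_add_card_filter_not (s := S) (· < c)
      have := (ih _ (by omega) rfl ha hc.1 (hc.2.le.trans hb) hL).append
        (ih _ (by omega) rfl (ha.trans hc.1.le) hc.2 hb hR)
      rwa [hsum, hcard, ← mul_add, Finset.sum_filter_add_sum_filter_not] at this
  · interval_cases n
    · rw [Finset.card_eq_zero] at hcard
      have := h.mass
      rw [hcard, Finset.sum_empty] at this
      linarith
    · obtain ⟨x, rfl⟩ := Finset.card_eq_one.1 hcard
      have hmass := h.mass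
      have hmom := h.moment
      rw [Finset.sum_singleton] at hmass hmom ⊢
      refine (PartitionAttains.single hab.le).mono ?_
      have hx : (Ψ b - Ψ a) / (Φ b - Φ a) = x := by
        rw [div_eq_iff (by linarith), ← hmom, ← hmass]; ring
      rw [cellValue, hx, ← hmass]
      nlinarith [mul_nonneg (hpos x (by simp)).le (hv x)]
    · obtain ⟨x, y, hxy, rfl⟩ := Finset.card_eq_two.1 hcard
      rw [Finset.sum_pair hxy]
      rcases lt_or_gt_of_ne hxy with hlt | hlt
      · exact h.half_of_pair hF hv ha hab hb hlt (hpos x (by simp)) (hpos y (by simp))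
      · rw [add_comm]
        rw [Finset.pair_comm] at h
        exact h.half_of_pair hF hv ha hab hb hlt (hpos y (by simp)) (hpos x (by simp))

end Core

/-! ### Signal probabilities, posterior means and expected utility -/

section Kernels

variable {F : Measure I} {K : ℕ} {π : Kernel I (Fin K)}

theorem measurable_kernel_real (π : Kernel I (Fin K)) (s : Fin K) :
    Measurable fun θ => (π θ).real {s} :=
  (π.measurable_coe (measurableSet_singleton s)).ennreal_toReal

theorem kernel_real_le_one [IsMarkovKernel π] (s : Fin K) (θ : I) : (π θ).real {s} ≤ 1 :=
  measureReal_le_one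

theorem sum_kernel_real [IsMarkovKernel π] (θ : I) : ∑ s, (π θ).real {s} = 1 := by
  simp

theorem integrable_of_mem_Icc [IsFiniteMeasure F] {f : I → ℝ} (hf : Measurable f)
    (h : ∀ θ, f θ ∈ Set.Icc (0 : ℝ) 1) : Integrable f F :=
  Integrable.of_bound hf.aestronglyMeasurable 1 (Filter.Eventually.of_forall fun θ => by
    rw [Real.norm_eq_abs, abs_of_nonneg (h θ).1]; exact (h θ).2)

theorem integrable_kernel_real [IsFiniteMeasure F] [IsMarkovKernel π] (s : Fin K) :
    Integrable (fun θ => (π θ).real {s}) F :=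
  integrable_of_mem_Icc (measurable_kernel_real π s)
    fun θ => ⟨measureReal_nonneg, kernel_real_le_one s θ⟩

theorem integrable_mul_kernel_real [IsFiniteMeasure F] [IsMarkovKernel π] (s : Fin K) :
    Integrable (fun θ : I => (θ : ℝ) * (π θ).real {s}) F :=
  integrable_of_mem_Icc (measurable_subtype_coe.mul (measurable_kernel_real π s))
    fun θ => ⟨mul_nonneg θ.2.1 measureReal_nonneg,
      mul_le_one₀ θ.2.2 measureReal_nonneg (kernel_real_le_one s θ)⟩

theorem integrable_coe [IsFiniteMeasure F] : Integrable (fun θ : I => (θ : ℝ)) F :=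
  integrable_of_mem_Icc measurable_subtype_coe fun θ => θ.2

theorem signalProb_nonneg (s : Fin K) : 0 ≤ signalProb F π s :=
  integral_nonneg fun _ => measureReal_nonneg

theorem sum_signalProb [IsProbabilityMeasure F] [IsMarkovKernel π] :
    ∑ s, signalProb F π s = 1 := by
  unfold signalProb
  rw [← integral_finsetSum _ fun s _ => integrable_kernel_real s]
  simp

theorem sum_signalMoment [IsProbabilityMeasure F] [IsMarkovKernel π] :
    ∑ s, signalMoment F π s = ∫ θ, (θ : ℝ) ∂F := by
  unfold signalMoment
  rw [← integral_finsetSum _ fun s _ => integrable_mul_kernel_real s]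
  simp [← Finset.mul_sum]

/-- This includes signals of probability zero, whose moment vanishes too because it is dominated by
the probability; the default posterior mean is thus harmless in sums. -/
theorem posteriorMean_mul_signalProb [IsProbabilityMeasure F] [IsMarkovKernel π] (s : Fin K) :
    (posteriorMean F π s : ℝ) * signalProb F π s = signalMoment F π s := by
  show signalMoment F π s / signalProb F π s * signalProb F π s = _
  by_cases h : signalProb F π s = 0
  · have h1 : signalMoment F π s ≤ signalProb F π s :=
      integral_mono (integrable_mul_kernel_real s) (integrable_kernel_real s)
        fun θ => mul_le_of_le_one_left measureReal_nonneg θ.2.2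
    have h2 : 0 ≤ signalMoment F π s :=
      integral_nonneg fun θ => mul_nonneg θ.2.1 measureReal_nonneg
    rw [h] at h1
    rw [h, mul_zero, le_antisymm h1 h2]
  · rw [div_mul_cancel₀ _ h]

theorem expectedUtility_eq_sum [IsProbabilityMeasure F] [IsMarkovKernel π] (u : I → I) :
    expectedUtility F u π = ∑ s, signalProb F π s * u (posteriorMean F π s) := by
  unfold expectedUtility
  simp_rw [integral_fintype (Integrable.of_finite), smul_eq_mul]
  rw [integral_finsetSum _ fun s _ => (integrable_kernel_real s).mul_const _]
  simp_rw [integral_mul_const]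
  rfl

theorem expectedUtility_nonneg [IsProbabilityMeasure F] [IsMarkovKernel π] (u : I → I) :
    0 ≤ expectedUtility F u π := by
  rw [expectedUtility_eq_sum]
  exact Finset.sum_nonneg fun s _ => mul_nonneg (signalProb_nonneg s) (u _).2.1

theorem expectedUtility_le_one [IsProbabilityMeasure F] [IsMarkovKernel π] (u : I → I) :
    expectedUtility F u π ≤ 1 := by
  rw [expectedUtility_eq_sum, ← sum_signalProb (F := F) (π := π)]
  exact Finset.sum_le_sum fun s _ => mul_le_of_le_one_right (signalProb_nonneg s) (u _).2.2

theorem bddAbove_schemeValues [IsProbabilityMeasure F] (u : I → I) (K : ℕ) :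
    BddAbove (schemeValues F u K) := by
  refine ⟨1, ?_⟩
  rintro _ ⟨π, hπ, rfl⟩
  exact expectedUtility_le_one u

theorem bddAbove_partitionalValues [IsProbabilityMeasure F] (u : I → I) (K : ℕ) :
    BddAbove (partitionalValues F u K) := by
  refine ⟨1, ?_⟩
  rintro _ ⟨π, hπ, -, rfl⟩
  exact expectedUtility_le_one u

/-- A deterministic assignment of the states to the cells of a partition. -/
theorem exists_cellIndex (hK : 0 < K) {a : Fin (K + 1) → I} (h0 : a 0 = 0)
    (h1 : a (Fin.last K) = 1) :
    ∃ j : I → Fin K, Measurable j ∧ ∀ θ, a (j θ).castSucc ≤ θ ∧ θ ≤ a (j θ).succ := by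
  obtain ⟨n, rfl⟩ : ∃ n, K = n + 1 := ⟨K - 1, by omega⟩
  have hne : ∀ θ : I, (Finset.univ.filter fun i : Fin (n + 1) => θ ≤ a i.succ).Nonempty :=
    fun θ => ⟨Fin.last n, by simpa [h1] using unitInterval.le_one'⟩
  -- The first cell whose right end is not below `θ`. The choice is monotone in `θ`, hence
  -- measurable, and minimality gives the left bound.
  refine ⟨fun θ => Finset.min' _ (hne θ), ?_, fun θ => ⟨?_, ?_⟩⟩
  · refine Monotone.measurable fun θ θ' hθ => Finset.min'_subset _ ?_
    exact Finset.monotone_filter_right _ fun i _ hi => hθ.trans hi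
  · obtain ⟨j, hj⟩ : ∃ j, Finset.min' _ (hne θ) = j := ⟨_, rfl⟩
    simp only [hj]
    cases j using Fin.cases with
    | zero => rw [Fin.castSucc_zero, h0]; exact unitInterval.nonneg'
    | succ k =>
      by_contra! hlt
      rw [← Fin.succ_castSucc] at hlt
      have := Finset.min'_le (Finset.univ.filter fun i : Fin (n + 1) => θ ≤ a i.succ) k.castSucc
        (Finset.mem_filter.2 ⟨Finset.mem_univ _, hlt.le⟩)
      rw [hj] at this
      exact absurd this (not_le.2 k.castSucc_lt_succ)
  · exact (Finset.mem_filter.1 (Finset.min'_mem _ (hne θ))).2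

end Kernels

/-! ### The mass and moment functions of a continuous prior -/

section LowerBound

/-- The probability that the state is at most `c`. -/
noncomputable def cumMass (F : Measure I) (c : ℝ) : ℝ := F.real {θ : I | (θ : ℝ) ≤ c}

/-- The integral of the state over the event that it is at most `c`. -/
noncomputable def cumMoment (F : Measure I) (c : ℝ) : ℝ := ∫ θ in {θ : I | (θ : ℝ) ≤ c}, (θ : ℝ) ∂F

variable {F : Measure I}

theorem measurableSet_coe_le (c : ℝ) : MeasurableSet {θ : I | (θ : ℝ) ≤ c} :=
  measurableSet_le measurable_subtype_coe measurable_const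

theorem measurableSet_coe_mem_Ioc (s t : ℝ) : MeasurableSet {θ : I | (θ : ℝ) ∈ Set.Ioc s t} :=
  measurable_subtype_coe measurableSet_Ioc

theorem setOf_coe_le_union {s t : ℝ} (hst : s ≤ t) :
    {θ : I | (θ : ℝ) ≤ t} = {θ : I | (θ : ℝ) ≤ s} ∪ {θ : I | (θ : ℝ) ∈ Set.Ioc s t} := by
  ext θ
  show (θ : ℝ) ≤ t ↔ (θ : ℝ) ≤ s ∨ (s < (θ : ℝ) ∧ (θ : ℝ) ≤ t)
  rcases le_or_gt (θ : ℝ) s with h | h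
  · exact ⟨fun _ => Or.inl h, fun _ => h.trans hst⟩
  · exact ⟨fun h' => Or.inr ⟨h, h'⟩, fun h' => h'.elim (fun h' => h'.trans hst) fun h' => h'.2⟩

theorem disjoint_coe_le_Ioc (s t : ℝ) :
    Disjoint {θ : I | (θ : ℝ) ≤ s} {θ : I | (θ : ℝ) ∈ Set.Ioc s t} :=
  Set.disjoint_left.2 fun _ h1 h2 => absurd h2.1 (not_lt.2 h1)

theorem cumMass_sub [IsFiniteMeasure F] {s t : ℝ} (hst : s ≤ t) :
    cumMass F t - cumMass F s = F.real {θ : I | (θ : ℝ) ∈ Set.Ioc s t} := by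
  rw [cumMass, setOf_coe_le_union hst,
    measureReal_union (disjoint_coe_le_Ioc s t) (measurableSet_coe_mem_Ioc s t), cumMass]
  ring

theorem cumMoment_sub [IsFiniteMeasure F] {s t : ℝ} (hst : s ≤ t) :
    cumMoment F t - cumMoment F s = ∫ θ in {θ : I | (θ : ℝ) ∈ Set.Ioc s t}, (θ : ℝ) ∂F := by
  rw [cumMoment, setOf_coe_le_union hst,
    setIntegral_union (disjoint_coe_le_Ioc s t) (measurableSet_coe_mem_Ioc s t)
      integrable_coe.integrableOn integrable_coe.integrableOn, cumMoment]
  ring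

theorem IsContinuousPrior.measure_singleton (hF : IsContinuousPrior F) (x : I) : F {x} = 0 :=
  hF.absolutelyContinuous (MeasureTheory.measure_singleton x)

theorem IsContinuousPrior.measure_coe_singleton (hF : IsContinuousPrior F) (c : ℝ) :
    F {θ : I | (θ : ℝ) = c} = 0 := by
  by_cases hc : c ∈ Set.Icc (0 : ℝ) 1
  · convert hF.measure_singleton ⟨c, hc⟩ using 2
    ext θ
    exact (Subtype.ext_iff (a1 := θ) (a2 := ⟨c, hc⟩)).symm
  · convert measure_empty (μ := F)
    ext θ
    exact ⟨fun h : (θ : ℝ) = c => hc (h ▸ θ.2), fun h => h.elim⟩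

theorem IsContinuousPrior.measure_Ioo_pos (hF : IsContinuousPrior F) {s t : ℝ} (hs : 0 ≤ s)
    (hst : s < t) (ht : t ≤ 1) : 0 < F {θ : I | (θ : ℝ) ∈ Set.Ioo s t} := by
  have := hF.fullSupport
  refine IsOpen.measure_pos F (isOpen_Ioo.preimage continuous_subtype_val) ?_
  exact ⟨⟨(s + t) / 2, by linarith, by linarith⟩,
    show (s + t) / 2 ∈ Set.Ioo s t from ⟨by linarith, by linarith⟩⟩

/-- Dominated convergence: the indicator of `θ ≤ c` is continuous in `c` except at `c = θ`, which is
a null event. -/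
theorem IsContinuousPrior.continuous_cumMass (hF : IsContinuousPrior F) :
    Continuous (cumMass F) := by
  have := hF.isProbabilityMeasure
  have h : cumMass F = fun c => ∫ θ, ({θ : I | (θ : ℝ) ≤ c}).indicator (fun _ => (1 : ℝ)) θ ∂F := by
    funext c
    rw [integral_indicator_const _ (measurableSet_coe_le c)]
    simp [cumMass]
  rw [h, continuous_iff_continuousAt]
  intro c
  refine continuousAt_of_dominated (bound := fun _ => 1) ?_ ?_ (integrable_const _) ?_
  · exact Filter.Eventually.of_forall fun c =>
      (measurable_const.indicator (measurableSet_coe_le c)).aestronglyMeasurable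
  · refine Filter.Eventually.of_forall fun c => Filter.Eventually.of_forall fun θ => ?_
    exact (norm_indicator_le_norm_self _ _).trans (by simp)
  · have : ∀ᵐ θ : I ∂F, (θ : ℝ) ≠ c := by
      rw [ae_iff]
      simpa only [not_not] using hF.measure_coe_singleton c
    filter_upwards [this] with θ hθ
    rcases lt_or_gt_of_ne hθ with h | h
    · refine (continuousAt_const (y := (1 : ℝ))).congr ?_
      filter_upwards [lt_mem_nhds h] with c' hc'
      exact (Set.indicator_of_mem (s := {θ : I | (θ : ℝ) ≤ c'}) (le_of_lt hc') fun _ => (1 : ℝ)).symm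
    · refine (continuousAt_const (y := (0 : ℝ))).congr ?_
      filter_upwards [gt_mem_nhds h] with c' hc'
      exact (Set.indicator_of_notMem (s := {θ : I | (θ : ℝ) ≤ c'}) (not_le.2 hc') fun _ => (1 : ℝ)).symm

theorem setIntegral_Ioc_pos (hF : IsContinuousPrior F) {s t : ℝ} (hs : 0 ≤ s) (hst : s < t)
    (ht : t ≤ 1) {g : I → ℝ} (hg : Continuous g)
    (h0 : ∀ θ : I, (θ : ℝ) ∈ Set.Ioc s t → 0 ≤ g θ)
    (hpos : ∀ θ : I, (θ : ℝ) ∈ Set.Ioo s t → 0 < g θ) :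
    0 < ∫ θ in {θ : I | (θ : ℝ) ∈ Set.Ioc s t}, g θ ∂F := by
  have := hF.isProbabilityMeasure
  have hint : Integrable g F := hg.integrable_of_hasCompactSupport (.of_compactSpace g)
  rw [setIntegral_pos_iff_support_of_nonneg_ae]
  · refine (hF.measure_Ioo_pos hs hst ht).trans_le (measure_mono fun θ hθ => ?_)
    exact ⟨(hpos θ hθ).ne', hθ.1, le_of_lt hθ.2⟩
  · exact (ae_restrict_iff' (measurableSet_coe_mem_Ioc s t)).2 (Filter.Eventually.of_forall h0)
  · exact hint.integrableOn

/-- The strict inequalities integrate `θ - s` and `t - θ` over `(s,t]`; full support makes these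
integrals positive. -/
theorem IsContinuousPrior.isMassMoment (hF : IsContinuousPrior F) :
    IsMassMoment (cumMass F) (cumMoment F) := by
  have := hF.isProbabilityMeasure
  have key : ∀ (r s t : ℝ), ∫ θ in {θ : I | (θ : ℝ) ∈ Set.Ioc s t}, ((θ : ℝ) - r) ∂F
      = ∫ θ in {θ : I | (θ : ℝ) ∈ Set.Ioc s t}, (θ : ℝ) ∂F
        - r * F.real {θ : I | (θ : ℝ) ∈ Set.Ioc s t} := by
    intro r s t
    rw [integral_sub integrable_coe.integrableOn (integrable_const r).integrableOn,
      setIntegral_const, smul_eq_mul, mul_comm]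
  refine ⟨hF.continuous_cumMass.continuousOn, fun s t hs hst ht => ?_, fun s t hs hst ht => ?_⟩
  · rw [cumMass_sub hst.le, cumMoment_sub hst.le]
    have := setIntegral_Ioc_pos hF hs hst ht (g := fun θ : I => (θ : ℝ) - s) (by fun_prop)
      (fun θ hθ => by linarith [hθ.1]) (fun θ hθ => by linarith [hθ.1])
    rw [key] at this
    linarith
  · rw [cumMass_sub hst.le, cumMoment_sub hst.le]
    have := setIntegral_Ioc_pos hF hs hst ht (g := fun θ : I => -((θ : ℝ) - t)) (by fun_prop)
      (fun θ hθ => by linarith [hθ.2]) (fun θ hθ => by linarith [hθ.2])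
    rw [integral_neg, key] at this
    linarith

end LowerBound

/-! ### From policies to poolings, and from partitions back to policies -/

section LowerBound

variable {F : Measure I} {K : ℕ} {π : Kernel I (Fin K)}

theorem integrable_of_continuous [IsFiniteMeasure F] {g : I → ℝ} (hg : Continuous g) :
    Integrable g F :=
  hg.integrable_of_hasCompactSupport (.of_compactSpace g)

theorem IsContinuousPrior.cumMass_zero (hF : IsContinuousPrior F) : cumMass F 0 = 0 := by
  have h : {θ : I | (θ : ℝ) ≤ 0} = {θ : I | (θ : ℝ) = 0} :=
    Set.ext fun θ => ⟨fun h => le_antisymm h θ.2.1, fun h => le_of_eq h⟩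
  rw [cumMass, h, measureReal_def, hF.measure_coe_singleton, ENNReal.toReal_zero]

theorem IsContinuousPrior.cumMoment_zero (hF : IsContinuousPrior F) : cumMoment F 0 = 0 := by
  have h : {θ : I | (θ : ℝ) ≤ 0} = {θ : I | (θ : ℝ) = 0} :=
    Set.ext fun θ => ⟨fun h => le_antisymm h θ.2.1, fun h => le_of_eq h⟩
  rw [cumMoment, h, setIntegral_measure_zero _ (hF.measure_coe_singleton 0)]

theorem setOf_coe_le_one : {θ : I | (θ : ℝ) ≤ 1} = Set.univ :=
  Set.eq_univ_of_forall fun θ => θ.2.2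

theorem cumMass_one [IsProbabilityMeasure F] : cumMass F 1 = 1 := by
  rw [cumMass, setOf_coe_le_one, probReal_univ]

theorem cumMoment_one : cumMoment F 1 = ∫ θ, (θ : ℝ) ∂F := by
  rw [cumMoment, setOf_coe_le_one, setIntegral_univ]

theorem integral_max_sub [IsProbabilityMeasure F] (c : ℝ) :
    ∫ θ : I, max (c - θ) 0 ∂F = c * cumMass F c - cumMoment F c := by
  have h : (fun θ : I => max (c - θ) 0)
      = ({θ : I | (θ : ℝ) ≤ c}).indicator fun θ : I => c - (θ : ℝ) := by
    funext θ
    by_cases hθ : (θ : ℝ) ≤ c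
    · rw [Set.indicator_of_mem (s := {θ : I | (θ : ℝ) ≤ c}) hθ, max_eq_left (by linarith)]
    · rw [Set.indicator_of_notMem (s := {θ : I | (θ : ℝ) ≤ c}) hθ, max_eq_right (by linarith)]
  rw [h, integral_indicator (measurableSet_coe_le c),
    integral_sub (integrable_const c).integrableOn integrable_coe.integrableOn,
    setIntegral_const, smul_eq_mul, mul_comm]
  rfl

/-- The distinct posterior means of a policy. -/
noncomputable def meanSet (F : Measure I) (π : Kernel I (Fin K)) : Finset ℝ :=
  Finset.univ.image fun s => (posteriorMean F π s : ℝ)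

/-- The probability that the posterior mean is `x`. -/
noncomputable def meanProb (F : Measure I) (π : Kernel I (Fin K)) (x : ℝ) : ℝ :=
  ∑ s with (posteriorMean F π s : ℝ) = x, signalProb F π s

/-- Signals with the same posterior mean are merged into one atom, which leaves sums of functions of
the mean unchanged. -/
theorem sum_meanProb_mul (f : ℝ → ℝ) :
    ∑ x ∈ meanSet F π, meanProb F π x * f x
      = ∑ s, signalProb F π s * f (posteriorMean F π s) := by
  rw [← Finset.sum_fiberwise_of_maps_to (s := Finset.univ) (t := meanSet F π)
    (g := fun s => (posteriorMean F π s : ℝ))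
    (fun s _ => Finset.mem_image_of_mem _ (Finset.mem_univ s))]
  refine Finset.sum_congr rfl fun x _ => ?_
  rw [meanProb, Finset.sum_mul]
  refine Finset.sum_congr rfl fun s hs => ?_
  rw [(Finset.mem_filter.1 hs).2]

/-- Jensen's inequality for the convex put payoff, conditional on one signal. -/
theorem signalProb_mul_max_le [IsProbabilityMeasure F] [IsMarkovKernel π] (c : ℝ) (s : Fin K) :
    signalProb F π s * max (c - posteriorMean F π s) 0
      ≤ ∫ θ : I, max (c - θ) 0 * (π θ).real {s} ∂F := by
  have hint : Integrable (fun θ : I => max (c - θ) 0 * (π θ).real {s}) F :=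
    (integrable_kernel_real s).bdd_mul (c := |c| + 1)
      (Measurable.aestronglyMeasurable (by fun_prop)) (Filter.Eventually.of_forall fun θ => by
        rw [Real.norm_eq_abs, abs_of_nonneg (le_max_right _ _)]
        exact max_le (by linarith [le_abs_self c, θ.2.1]) (by positivity))
  rw [mul_max_of_nonneg _ _ (signalProb_nonneg s), mul_zero]
  refine max_le ?_ (integral_nonneg fun θ => mul_nonneg (le_max_right _ _) measureReal_nonneg)
  have h1 : signalProb F π s * (c - posteriorMean F π s)
      = ∫ θ : I, (c * (π θ).real {s} - (θ : ℝ) * (π θ).real {s}) ∂F := by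
    rw [integral_sub ((integrable_kernel_real s).const_mul c) (integrable_mul_kernel_real s),
      integral_const_mul]
    have := posteriorMean_mul_signalProb (F := F) (π := π) s
    unfold signalMoment at this
    rw [← this]
    unfold signalProb
    ring
  rw [h1]
  refine integral_mono (((integrable_kernel_real s).const_mul c).sub
    (integrable_mul_kernel_real s)) hint fun θ => ?_
  show c * (π θ).real {s} - (θ : ℝ) * (π θ).real {s} ≤ max (c - θ) 0 * (π θ).real {s}
  rw [← sub_mul]
  exact mul_le_mul_of_nonneg_right (le_max_left _ _) measureReal_nonneg

theorem sum_signalProb_mul_max_le [IsProbabilityMeasure F] [IsMarkovKernel π] (c : ℝ) :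
    ∑ s, signalProb F π s * max (c - posteriorMean F π s) 0
      ≤ c * cumMass F c - cumMoment F c := by
  refine (Finset.sum_le_sum fun s _ => signalProb_mul_max_le c s).trans_eq ?_
  rw [← integral_finsetSum, ← integral_max_sub]
  · simp [← Finset.mul_sum]
  · intro s _
    exact (integrable_kernel_real s).bdd_mul (c := |c| + 1)
      (Measurable.aestronglyMeasurable (by fun_prop)) (Filter.Eventually.of_forall fun θ => by
        rw [Real.norm_eq_abs, abs_of_nonneg (le_max_right _ _)]
        exact max_le (by linarith [le_abs_self c, θ.2.1]) (by positivity))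

theorem IsContinuousPrior.isPooling (hF : IsContinuousPrior F) [IsMarkovKernel π] :
    IsPooling (cumMass F) (cumMoment F) 0 1 (meanSet F π) (meanProb F π) := by
  have := hF.isProbabilityMeasure
  refine ⟨fun x _ => Finset.sum_nonneg fun s _ => signalProb_nonneg s, ?_, ?_, fun c hc => ?_⟩
  · have := sum_meanProb_mul (F := F) (π := π) fun _ => 1
    simp only [mul_one] at this
    rw [this, sum_signalProb, cumMass_one, hF.cumMass_zero, sub_zero]
  · have := sum_meanProb_mul (F := F) (π := π) fun x => x
    rw [this, cumMoment_one, hF.cumMoment_zero, sub_zero, ← sum_signalMoment (π := π)]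
    refine Finset.sum_congr rfl fun s _ => ?_
    rw [mul_comm, posteriorMean_mul_signalProb]
  · rw [putSum, sum_meanProb_mul (F := F) (π := π) fun x => max (c - x) 0, putIntegral,
      hF.cumMass_zero, hF.cumMoment_zero, sub_zero, sub_zero]
    exact sum_signalProb_mul_max_le c

theorem signalProb_deterministic {j : I → Fin K} (hj : Measurable j) (s : Fin K) :
    signalProb F (Kernel.deterministic j hj) s = F.real (j ⁻¹' {s}) := by
  have h : (fun θ => (Kernel.deterministic j hj θ).real {s})
      = (j ⁻¹' {s}).indicator fun _ => (1 : ℝ) := by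
    funext θ
    rw [measureReal_def, Kernel.deterministic_apply' hj θ (measurableSet_singleton s)]
    by_cases hθ : j θ = s <;> simp [Set.indicator, hθ]
  rw [signalProb, h, integral_indicator_const _ (hj (measurableSet_singleton s))]
  simp

theorem signalMoment_deterministic {j : I → Fin K} (hj : Measurable j) (s : Fin K) :
    signalMoment F (Kernel.deterministic j hj) s = ∫ θ in j ⁻¹' {s}, (θ : ℝ) ∂F := by
  have h : (fun θ : I => (θ : ℝ) * (Kernel.deterministic j hj θ).real {s})
      = (j ⁻¹' {s}).indicator fun θ : I => (θ : ℝ) := by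
    funext θ
    rw [measureReal_def, Kernel.deterministic_apply' hj θ (measurableSet_singleton s)]
    by_cases hθ : j θ = s <;> simp [Set.indicator, hθ]
  rw [signalMoment, h, integral_indicator (hj (measurableSet_singleton s))]

/-- Partition points are null, so it does not matter to which adjacent cell they are assigned. -/
theorem IsContinuousPrior.cell_ae_eq (hF : IsContinuousPrior F) {a : Fin (K + 1) → I}
    (ha : Monotone a) {j : I → Fin K} (hj : ∀ θ, a (j θ).castSucc ≤ θ ∧ θ ≤ a (j θ).succ)
    (s : Fin K) :
    (j ⁻¹' {s} : Set I) =ᵐ[F]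
      {θ : I | (θ : ℝ) ∈ Set.Ioc (a s.castSucc : ℝ) (a s.succ)} := by
  have hne : ∀ᵐ θ ∂F, ∀ k, θ ≠ a k := by
    rw [ae_all_iff]
    intro k
    rw [ae_iff]
    simpa using hF.measure_singleton (a k)
  filter_upwards [hne] with θ hθ
  refine propext ⟨fun h : j θ = s => ?_, fun h : a s.castSucc < θ ∧ θ ≤ a s.succ => ?_⟩
  · subst h
    exact ⟨(lt_of_le_of_ne (hj θ).1 (hθ _).symm : a (j θ).castSucc < θ), (hj θ).2⟩
  · show j θ = s
    obtain ⟨h1, h2⟩ := hj θ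
    rcases lt_trichotomy (j θ) s with hlt | heq | hgt
    · have : a (j θ).succ ≤ a s.castSucc := ha (by
        rw [Fin.le_def]; simpa using hlt)
      exact absurd (h2.trans this) (not_le.2 h.1)
    · exact heq
    · have : a s.succ ≤ a (j θ).castSucc := ha (by
        rw [Fin.le_def]; simpa using hgt)
      exact absurd (le_antisymm (h.2.trans this) h1) (hθ _)

/-- A partition of `[0,1]` into cells yields a partitional policy with the same value. -/
theorem IsContinuousPrior.exists_partitional (hF : IsContinuousPrior F) (u : I → I) (hK : 0 < K)
    {r : ℝ} (h : PartitionAttains (cellValue (cumMass F) (cumMoment F)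
      fun x => (u (Set.projIcc 0 1 zero_le_one x) : ℝ)) K 0 1 r) :
    ∃ v ∈ partitionalValues F u K, r ≤ v := by
  have := hF.isProbabilityMeasure
  obtain ⟨t, hmono, ht0, htK, hr⟩ := h
  have hmem : ∀ i : Fin (K + 1), t i ∈ Set.Icc (0 : ℝ) 1 := fun i =>
    ⟨ht0 ▸ hmono (Nat.zero_le _), htK ▸ hmono (Nat.lt_succ_iff.1 i.2)⟩
  let a : Fin (K + 1) → I := fun i => ⟨t i, hmem i⟩
  have ha : Monotone a := fun i k hik => hmono (Fin.le_def.1 hik)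
  have ha0 : a 0 = 0 := Subtype.ext ht0
  have ha1 : a (Fin.last K) = 1 := Subtype.ext htK
  obtain ⟨j, hjm, hj⟩ := exists_cellIndex hK ha0 ha1
  refine ⟨_, ⟨Kernel.deterministic j hjm, inferInstance, ⟨a, ha, ha0, ha1, fun i θ hi => ?_⟩, rfl⟩,
    hr.trans_eq ?_⟩
  · rw [Kernel.deterministic_apply' hjm θ (measurableSet_singleton i)] at hi
    have : j θ = i := by
      by_contra hne
      exact hi (by simp [Set.indicator, hne])
    exact this ▸ hj θ
  · rw [expectedUtility_eq_sum, Finset.sum_range]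
    refine Finset.sum_congr rfl fun s _ => ?_
    have hle : t s ≤ t (s + 1) := hmono (Nat.le_succ _)
    have hae := hF.cell_ae_eq ha hj s
    have hp : signalProb F (Kernel.deterministic j hjm) s
        = cumMass F (t (s + 1)) - cumMass F (t s) := by
      rw [signalProb_deterministic, cumMass_sub hle]
      exact measureReal_congr hae
    have hm : signalMoment F (Kernel.deterministic j hjm) s
        = cumMoment F (t (s + 1)) - cumMoment F (t s) := by
      rw [signalMoment_deterministic, cumMoment_sub hle]
      exact setIntegral_congr_set hae
    rw [cellValue, ← hp, ← hm]
    congr 3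
    exact Set.projIcc_of_mem zero_le_one (posteriorMean F (Kernel.deterministic j hjm) s).2

/-- Every policy is worth at most twice as much as some partitional policy. -/
theorem IsContinuousPrior.exists_half_le (hF : IsContinuousPrior F) (u : I → I) (hK : 0 < K)
    [IsMarkovKernel π] :
    ∃ v ∈ partitionalValues F u K, (1 / 2) * expectedUtility F u π ≤ v := by
  have := hF.isProbabilityMeasure
  refine hF.exists_partitional u hK ?_
  have hcard : (meanSet F π).card ≤ K :=
    Finset.card_image_le.trans_eq (by simp)
  have h := (IsPooling.half_le_partition
    (v := fun x => (u (Set.projIcc 0 1 zero_le_one x) : ℝ)) hF.isMassMoment (fun x => (u _).2.1) _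
    rfl le_rfl one_pos le_rfl (hF.isPooling (π := π))).pad cellValue_self hcard
  refine h.mono (le_of_eq ?_)
  rw [sum_meanProb_mul, expectedUtility_eq_sum]
  simp

end LowerBound

/-! ### Attainment of both optima by compactness -/

section Existence

open Filter Topology

/-- The pairing between continuous functions and probability measures is jointly continuous. -/
theorem continuous_integral_pairing {X : Type*} [TopologicalSpace X] [CompactSpace X]
    [MeasurableSpace X] [OpensMeasurableSpace X] :
    Continuous fun p : C(X, ℝ) × ProbabilityMeasure X => ∫ x, p.1 x ∂(p.2 : Measure X) := by
  have hint : ∀ (f : C(X, ℝ)) (ρ : ProbabilityMeasure X), Integrable f (ρ : Measure X) :=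
    fun f ρ => f.continuous.integrable_of_hasCompactSupport (.of_compactSpace f)
  rw [continuous_iff_continuousAt]
  rintro ⟨f₀, ρ₀⟩
  -- The first term is at most the sup distance to `f₀`, uniformly in the measure; the second is
  -- weakly continuous.
  have hsplit : (fun p : C(X, ℝ) × ProbabilityMeasure X => ∫ x, p.1 x ∂(p.2 : Measure X))
      = fun p => ∫ x, (p.1 - f₀) x ∂(p.2 : Measure X) + ∫ x, f₀ x ∂(p.2 : Measure X) := by
    funext p
    rw [← integral_add (hint _ _) (hint _ _)]
    simp
  have h1 : Tendsto (fun p : C(X, ℝ) × ProbabilityMeasure X =>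
      ∫ x, (p.1 - f₀) x ∂(p.2 : Measure X)) (𝓝 (f₀, ρ₀)) (𝓝 0) := by
    have hn : Tendsto (fun p : C(X, ℝ) × ProbabilityMeasure X => ‖p.1 - f₀‖) (𝓝 (f₀, ρ₀))
        (𝓝 0) := by
      have : Continuous fun p : C(X, ℝ) × ProbabilityMeasure X => ‖p.1 - f₀‖ := by fun_prop
      simpa using this.tendsto (f₀, ρ₀)
    refine squeeze_zero_norm (fun p => ?_) hn
    refine (norm_integral_le_of_norm_le_const
      (Eventually.of_forall fun x => (p.1 - f₀).norm_coe_le_norm x)).trans ?_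
    simp
  have h2 : Tendsto (fun p : C(X, ℝ) × ProbabilityMeasure X => ∫ x, f₀ x ∂(p.2 : Measure X))
      (𝓝 (f₀, ρ₀)) (𝓝 (∫ x, f₀ x ∂(ρ₀ : Measure X))) :=
    ((ProbabilityMeasure.continuous_integral_continuousMap f₀).comp continuous_snd).tendsto _
  rw [hsplit]
  simpa [ContinuousAt] using h1.add h2

/-- A posterior mean may be discontinuous where its signal has probability zero. There the product
is squeezed between `0` and `p`, since `u` is at most `1`; elsewhere the semicontinuity of `u`
carries over. -/
theorem upperSemicontinuous_mul_comp {α : Type*} [TopologicalSpace α] {p : α → ℝ}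
    (hp : Continuous p) (hp0 : ∀ x, 0 ≤ p x) {X : α → I} (hX : ∀ x, p x ≠ 0 → ContinuousAt X x)
    {u : I → I} (hu : UpperSemicontinuous u) :
    UpperSemicontinuous fun x => p x * (u (X x) : ℝ) := by
  intro x y hy
  change p x * (u (X x) : ℝ) < y at hy
  by_cases hx : p x = 0
  · rw [hx, zero_mul] at hy
    filter_upwards [hp.continuousAt.eventually (gt_mem_nhds (hx.trans_lt hy))] with x' hx'
    exact (mul_le_of_le_one_right (hp0 x') (u _).2.2).trans_lt hx'
  · have hu' : UpperSemicontinuous fun θ => (u θ : ℝ) :=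
      continuous_subtype_val.comp_upperSemicontinuous hu fun _ _ h => h
    have hpx : 0 < p x := lt_of_le_of_ne (hp0 x) (Ne.symm hx)
    have hlt : (u (X x) : ℝ) < y / p x := by
      rw [lt_div_iff₀ hpx, mul_comm]; exact hy
    obtain ⟨z, hz1, hz2⟩ := exists_between hlt
    rw [lt_div_iff₀ hpx] at hz2
    have h1 : ∀ᶠ x' in 𝓝 x, (u (X x') : ℝ) < z := (hX x hx).eventually (hu' (X x) z hz1)
    have h2 : ∀ᶠ x' in 𝓝 x, z * p x' < y :=
      (continuous_const.mul hp).continuousAt.eventually (gt_mem_nhds hz2)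
    filter_upwards [h1, h2] with x' hx1 hx2
    nlinarith [hp0 x']

variable {F : Measure I} {K : ℕ} {π : Kernel I (Fin K)}

/-- The indicator of the signal `s`. -/
def isSignal (s : Fin K) (z : I × Fin K) : ℝ := if z.2 = s then 1 else 0

theorem continuous_isSignal (s : Fin K) : Continuous (isSignal s) :=
  (continuous_of_discreteTopology (f := fun k : Fin K => if k = s then (1 : ℝ) else 0)).comp
    continuous_snd

/-- The probability of a signal under a joint law of state and signal. -/
noncomputable def jointProb (ρ : Measure (I × Fin K)) (s : Fin K) : ℝ := ∫ z, isSignal s z ∂ρ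

/-- The integral of the state over the event of a signal under a joint law. -/
noncomputable def jointMoment (ρ : Measure (I × Fin K)) (s : Fin K) : ℝ :=
  ∫ z, (z.1 : ℝ) * isSignal s z ∂ρ

/-- The posterior mean after a signal under a joint law. -/
noncomputable def jointMean (ρ : Measure (I × Fin K)) (s : Fin K) : I :=
  Set.projIcc 0 1 zero_le_one (jointMoment ρ s / jointProb ρ s)

/-- The expected utility under a joint law of state and signal. -/
noncomputable def jointValue (u : I → I) (ρ : Measure (I × Fin K)) : ℝ :=
  ∑ s, jointProb ρ s * (u (jointMean ρ s) : ℝ)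

theorem integrable_of_continuous_prod {ρ : Measure (I × Fin K)} [IsFiniteMeasure ρ]
    {g : I × Fin K → ℝ} (hg : Continuous g) : Integrable g ρ :=
  hg.integrable_of_hasCompactSupport (.of_compactSpace g)

theorem integral_compProd_fin [IsProbabilityMeasure F] [IsMarkovKernel π] {g : I × Fin K → ℝ}
    (hg : Continuous g) : ∫ z, g z ∂(F ⊗ₘ π) = ∫ θ, ∑ s, (π θ).real {s} * g (θ, s) ∂F := by
  rw [Measure.integral_compProd (integrable_of_continuous_prod hg)]
  simp_rw [integral_fintype (Integrable.of_finite), smul_eq_mul]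

theorem jointProb_compProd [IsProbabilityMeasure F] [IsMarkovKernel π] (s : Fin K) :
    jointProb (F ⊗ₘ π) s = signalProb F π s := by
  rw [jointProb, integral_compProd_fin (continuous_isSignal s)]
  simp [isSignal, signalProb]

theorem jointMoment_compProd [IsProbabilityMeasure F] [IsMarkovKernel π] (s : Fin K) :
    jointMoment (F ⊗ₘ π) s = signalMoment F π s := by
  rw [jointMoment, integral_compProd_fin (g := fun z => (z.1 : ℝ) * isSignal s z)
    ((continuous_subtype_val.comp continuous_fst).mul (continuous_isSignal s))]
  simp [isSignal, signalMoment, mul_comm]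

theorem jointValue_compProd [IsProbabilityMeasure F] [IsMarkovKernel π] (u : I → I) :
    jointValue u (F ⊗ₘ π) = expectedUtility F u π := by
  rw [expectedUtility_eq_sum, jointValue]
  refine Finset.sum_congr rfl fun s _ => ?_
  rw [jointMean, jointProb_compProd, jointMoment_compProd]
  congr 3
  exact Set.projIcc_of_mem zero_le_one (posteriorMean F π s).2

theorem upperSemicontinuous_jointValue {u : I → I} (hu : UpperSemicontinuous u) :
    UpperSemicontinuous fun ρ : ProbabilityMeasure (I × Fin K) =>
      jointValue u (ρ : Measure (I × Fin K)) := by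
  have hp : ∀ s, Continuous fun ρ : ProbabilityMeasure (I × Fin K) => jointProb (ρ : Measure (I × Fin K)) s :=
    fun s => ProbabilityMeasure.continuous_integral_continuousMap
      (⟨_, continuous_isSignal s⟩ : C(I × Fin K, ℝ))
  have hm : ∀ s, Continuous fun ρ : ProbabilityMeasure (I × Fin K) =>
      jointMoment (ρ : Measure (I × Fin K)) s :=
    fun s => ProbabilityMeasure.continuous_integral_continuousMap
      (⟨_, (continuous_subtype_val.comp continuous_fst).mul (continuous_isSignal s)⟩ :
        C(I × Fin K, ℝ))
  refine upperSemicontinuous_sum fun s _ => ?_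
  refine upperSemicontinuous_mul_comp (hp s) (fun ρ => integral_nonneg fun z => ?_)
    (fun ρ hρ => ?_) hu
  · unfold isSignal
    positivity
  · exact continuous_projIcc.continuousAt.comp ((hm s).continuousAt.div (hp s).continuousAt hρ)

/-- The joint law of state and signal under a policy. -/
noncomputable def jointLaw (F : Measure I) [IsProbabilityMeasure F] (π : Kernel I (Fin K))
    [IsMarkovKernel π] : ProbabilityMeasure (I × Fin K) := ⟨F ⊗ₘ π, inferInstance⟩

/-- The joint laws of state and signal with a given law of the state. -/
def jointLaws (F : Measure I) [IsProbabilityMeasure F] (K : ℕ) :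
    Set (ProbabilityMeasure (I × Fin K)) :=
  {ρ | ρ.map measurable_fst.aemeasurable = ⟨F, inferInstance⟩}

theorem isClosed_jointLaws (F : Measure I) [IsProbabilityMeasure F] (K : ℕ) :
    IsClosed (jointLaws F K) :=
  isClosed_eq (ProbabilityMeasure.continuous_map continuous_fst) continuous_const

theorem mem_jointLaws_iff [IsProbabilityMeasure F] {ρ : ProbabilityMeasure (I × Fin K)} :
    ρ ∈ jointLaws F K ↔ (ρ : Measure (I × Fin K)).fst = F :=
  Subtype.ext_iff

theorem compProd_mem_jointLaws [IsProbabilityMeasure F] [IsMarkovKernel π] :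
    jointLaw F π ∈ jointLaws F K :=
  mem_jointLaws_iff.2 (Measure.fst_compProd F π)

/-- Disintegration: passing to joint laws loses no policy and adds none. -/
theorem exists_kernel_of_mem_jointLaws [IsProbabilityMeasure F] (hK : 0 < K)
    {ρ : ProbabilityMeasure (I × Fin K)} (hρ : ρ ∈ jointLaws F K) :
    ∃ π : Kernel I (Fin K), IsMarkovKernel π ∧ (ρ : Measure (I × Fin K)) = F ⊗ₘ π := by
  have : Nonempty (Fin K) := ⟨⟨0, hK⟩⟩
  refine ⟨(ρ : Measure (I × Fin K)).condKernel, inferInstance, ?_⟩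
  have h := (ρ : Measure (I × Fin K)).disintegrate (ρ : Measure (I × Fin K)).condKernel
  rw [mem_jointLaws_iff.1 hρ] at h
  exact h.symm

theorem isGreatest_opt [IsProbabilityMeasure F] {u : I → I} (hu : UpperSemicontinuous u)
    (hK : 0 < K) : IsGreatest (schemeValues F u K) (opt F u K) := by
  obtain ⟨ρ, hρ, hmax⟩ := (upperSemicontinuous_jointValue hu).upperSemicontinuousOn
    (jointLaws F K) |>.exists_isMaxOn
      ⟨_, compProd_mem_jointLaws (π := Kernel.const I (Measure.dirac ⟨0, hK⟩))⟩
      (isClosed_jointLaws F K).isCompact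
  obtain ⟨π, hπ, hρπ⟩ := exists_kernel_of_mem_jointLaws hK hρ
  have hg : IsGreatest (schemeValues F u K) (expectedUtility F u π) := by
    refine ⟨⟨π, hπ, rfl⟩, ?_⟩
    rintro _ ⟨π', hπ', rfl⟩
    have h : jointValue u (F ⊗ₘ π') ≤ jointValue u (ρ : Measure (I × Fin K)) :=
      hmax (compProd_mem_jointLaws (F := F) (π := π'))
    rwa [hρπ, jointValue_compProd, jointValue_compProd] at h
  rw [opt, hg.csSup_eq]
  exact hg

/-- The distance of the state to the cell of the signal. -/
def cellSlack (a : Fin (K + 1) → I) (z : I × Fin K) : ℝ :=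
  ∑ i, isSignal i z * (max ((a i.castSucc : ℝ) - z.1) 0 + max ((z.1 : ℝ) - a i.succ) 0)

theorem continuous_cellSlack :
    Continuous fun p : (Fin (K + 1) → I) × (I × Fin K) => cellSlack p.1 p.2 := by
  refine continuous_finsetSum _ fun i _ => ?_
  refine ((continuous_isSignal i).comp continuous_snd).mul ?_
  fun_prop

theorem cellSlack_apply (a : Fin (K + 1) → I) (θ : I) (i : Fin K) :
    cellSlack a (θ, i) = max ((a i.castSucc : ℝ) - θ) 0 + max ((θ : ℝ) - a i.succ) 0 := by
  simp [cellSlack, isSignal]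

theorem cellSlack_nonneg (a : Fin (K + 1) → I) (z : I × Fin K) : 0 ≤ cellSlack a z := by
  rw [← Prod.mk.eta (p := z), cellSlack_apply]
  positivity

theorem cellSlack_eq_zero_iff (a : Fin (K + 1) → I) (θ : I) (i : Fin K) :
    cellSlack a (θ, i) = 0 ↔ a i.castSucc ≤ θ ∧ θ ≤ a i.succ := by
  rw [cellSlack_apply, add_eq_zero_iff_of_nonneg (le_max_right _ _) (le_max_right _ _),
    max_eq_right_iff, max_eq_right_iff, sub_nonpos, sub_nonpos]
  rfl

/-- The partitions of `[0,1]` together with the joint laws of the policies that respect them. -/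
def partitionalLaws (F : Measure I) [IsProbabilityMeasure F] (K : ℕ) :
    Set ((Fin (K + 1) → I) × ProbabilityMeasure (I × Fin K)) :=
  {p | Monotone p.1 ∧ p.1 0 = 0 ∧ p.1 (Fin.last K) = 1 ∧ p.2 ∈ jointLaws F K ∧
    ∫ z, cellSlack p.1 z ∂(p.2 : Measure (I × Fin K)) = 0}

/-- Respecting a partition is a closed condition, as the expected violation `cellSlack` is jointly
continuous in the partition and the law. -/
theorem isClosed_partitionalLaws (F : Measure I) [IsProbabilityMeasure F] (K : ℕ) :
    IsClosed (partitionalLaws F K) := by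
  have h1 : IsClosed {p : (Fin (K + 1) → I) × ProbabilityMeasure (I × Fin K) | Monotone p.1} :=
    isClosed_monotone.preimage continuous_fst
  have h2 : IsClosed {p : (Fin (K + 1) → I) × ProbabilityMeasure (I × Fin K) | p.1 0 = 0} :=
    isClosed_eq (by fun_prop) continuous_const
  have h3 : IsClosed {p : (Fin (K + 1) → I) × ProbabilityMeasure (I × Fin K) |
      p.1 (Fin.last K) = 1} := isClosed_eq (by fun_prop) continuous_const
  have h4 : IsClosed {p : (Fin (K + 1) → I) × ProbabilityMeasure (I × Fin K) |
      p.2 ∈ jointLaws F K} := (isClosed_jointLaws F K).preimage continuous_snd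
  have hc : Continuous fun p : (Fin (K + 1) → I) × ProbabilityMeasure (I × Fin K) =>
      ∫ z, cellSlack p.1 z ∂(p.2 : Measure (I × Fin K)) :=
    continuous_integral_pairing.comp
      ((((⟨_, continuous_cellSlack⟩ : C((Fin (K + 1) → I) × (I × Fin K), ℝ)).curry.continuous).comp
        continuous_fst).prodMk continuous_snd)
  exact h1.inter (h2.inter (h3.inter (h4.inter (isClosed_eq hc continuous_const))))

theorem mem_partitionalLaws [IsProbabilityMeasure F] [IsMarkovKernel π] {a : Fin (K + 1) → I}
    (ha : Monotone a) (h0 : a 0 = 0) (h1 : a (Fin.last K) = 1)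
    (hπ : ∀ (i : Fin K) (θ : I), π θ {i} ≠ 0 → a i.castSucc ≤ θ ∧ θ ≤ a i.succ) :
    (a, jointLaw F π) ∈ partitionalLaws F K := by
  refine ⟨ha, h0, h1, compProd_mem_jointLaws, ?_⟩
  show ∫ z, cellSlack a z ∂(F ⊗ₘ π) = 0
  rw [integral_compProd_fin (g := cellSlack a)
    (continuous_cellSlack.comp (Continuous.prodMk_right a))]
  refine integral_eq_zero_of_ae (Eventually.of_forall fun θ => Finset.sum_eq_zero fun i _ => ?_)
  by_cases hi : π θ {i} = 0
  · rw [measureReal_def, hi, ENNReal.toReal_zero, zero_mul]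
  · rw [(cellSlack_eq_zero_iff a θ i).2 (hπ i θ hi), mul_zero]

theorem exists_partitional_of_mem_partitionalLaws [IsProbabilityMeasure F] (hK : 0 < K)
    {p : (Fin (K + 1) → I) × ProbabilityMeasure (I × Fin K)} (hp : p ∈ partitionalLaws F K) :
    ∃ π : Kernel I (Fin K), IsMarkovKernel π ∧ IsPartitional π ∧
      (p.2 : Measure (I × Fin K)) = F ⊗ₘ π := by
  obtain ⟨a, ρ⟩ := p
  obtain ⟨ha, h0, h1, hρ, hs⟩ := hp
  obtain ⟨π, hπ, hρπ⟩ := exists_kernel_of_mem_jointLaws hK hρ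
  obtain ⟨j, hjm, hj⟩ := exists_cellIndex hK h0 h1
  simp only at hs hρπ ha
  -- Vanishing expected slack gives the cell condition only for almost every state, while
  -- `IsPartitional` demands it everywhere. Off `G`, a null set, the kernel is replaced by a
  -- deterministic choice of cell.
  let G : Set I := ⋂ i : Fin K, ({θ | π θ {i} = 0} ∪ {θ | a i.castSucc ≤ θ ∧ θ ≤ a i.succ})
  have hG : MeasurableSet G := by
    refine MeasurableSet.iInter fun i => MeasurableSet.union ?_ ?_
    · exact π.measurable_coe (measurableSet_singleton i) (measurableSet_singleton 0)
    · exact measurableSet_Icc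
  have hae : ∀ᵐ θ ∂F, θ ∈ G := by
    have hc : Continuous (cellSlack a) := continuous_cellSlack.comp (Continuous.prodMk_right a)
    rw [hρπ] at hs
    have h2 := (integral_eq_zero_iff_of_nonneg (cellSlack_nonneg a)
      (integrable_of_continuous_prod hc)).1 hs
    filter_upwards [Measure.ae_ae_of_ae_compProd h2] with θ hθ
    rw [ae_iff_of_countable] at hθ
    refine Set.mem_iInter.2 fun i => ?_
    by_cases hi : π θ {i} = 0
    · exact Or.inl hi
    · exact Or.inr ((cellSlack_eq_zero_iff a θ i).1 (hθ i hi))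
  classical
  refine ⟨Kernel.piecewise hG π (Kernel.deterministic j hjm), inferInstance,
    ⟨a, ha, h0, h1, fun i θ hi => ?_⟩, ?_⟩
  · rw [Kernel.piecewise_apply'] at hi
    split_ifs at hi with hθ
    · exact (Set.mem_iInter.1 hθ i).resolve_left hi
    · rw [Kernel.deterministic_apply' hjm θ (measurableSet_singleton i)] at hi
      have : j θ = i := by
        by_contra hne
        exact hi (by simp [Set.indicator, hne])
      exact this ▸ hj θ
  · rw [hρπ]
    refine Measure.compProd_congr ?_
    filter_upwards [hae] with θ hθ
    rw [Kernel.piecewise_apply, if_pos hθ]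

theorem isGreatest_optPart [IsProbabilityMeasure F] {u : I → I} (hu : UpperSemicontinuous u)
    (hK : 0 < K) : IsGreatest (partitionalValues F u K) (optPart F u K) := by
  have hne : (partitionalLaws F K).Nonempty := by
    -- The trivial partition, whose first cell is all of `[0,1]`, shows that the feasible set is
    -- nonempty.
    have ha : Monotone fun i : Fin (K + 1) => if i = 0 then (0 : I) else 1 := by
      intro i k hik
      by_cases hi : i = 0
      · simp only [hi, if_true]
        exact unitInterval.nonneg'
      · have hk : k ≠ 0 := fun hk => hi (Fin.le_zero_iff.1 (hk ▸ hik))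
        simp [hi, hk]
    have hl : Fin.last K ≠ 0 := fun h => by
      have := congrArg Fin.val h
      simp at this
      omega
    obtain ⟨j, hjm, hj⟩ := exists_cellIndex hK (a := fun i => if i = 0 then (0 : I) else 1)
      (if_pos rfl) (if_neg hl)
    refine ⟨_, mem_partitionalLaws (π := Kernel.deterministic j hjm) ha (if_pos rfl) (if_neg hl)
      fun i θ hi => ?_⟩
    rw [Kernel.deterministic_apply' hjm θ (measurableSet_singleton i)] at hi
    have : j θ = i := by
      by_contra hne
      exact hi (by simp [Set.indicator, hne])
    exact this ▸ hj θ
  have husc : UpperSemicontinuous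
      fun p : (Fin (K + 1) → I) × ProbabilityMeasure (I × Fin K) =>
        jointValue u (p.2 : Measure (I × Fin K)) :=
    (upperSemicontinuous_jointValue hu).comp continuous_snd
  obtain ⟨p, hp, hmax⟩ := (husc.upperSemicontinuousOn (partitionalLaws F K)).exists_isMaxOn hne
    (isClosed_partitionalLaws F K).isCompact
  obtain ⟨π, hπ, hpart, hρπ⟩ := exists_partitional_of_mem_partitionalLaws hK hp
  have hg : IsGreatest (partitionalValues F u K) (expectedUtility F u π) := by
    refine ⟨⟨π, hπ, hpart, rfl⟩, ?_⟩
    rintro _ ⟨π', hπ', ⟨a, ha, h0, h1, hs⟩, rfl⟩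
    have h : jointValue u (F ⊗ₘ π') ≤ jointValue u (p.2 : Measure (I × Fin K)) :=
      hmax (mem_partitionalLaws (F := F) ha h0 h1 hs)
    rwa [hρπ, jointValue_compProd, jointValue_compProd] at h
  rw [optPart, hg.csSup_eq]
  exact hg

theorem optimaAttained [IsProbabilityMeasure F] {u : I → I} (hu : UpperSemicontinuous u)
    (hK : 0 < K) : OptimaAttained F u K :=
  ⟨isGreatest_opt hu hK, isGreatest_optPart hu hK⟩

theorem IsContinuousPrior.half_opt_le (hF : IsContinuousPrior F) (u : I → I) (hK : 0 < K) :
    (1 / 2 : ℝ) * opt F u K ≤ optPart F u K := by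
  have := hF.isProbabilityMeasure
  have hle : opt F u K ≤ 2 * optPart F u K := by
    refine csSup_le
      ⟨_, Kernel.const I (Measure.dirac ⟨0, hK⟩), inferInstance, rfl⟩ ?_
    rintro _ ⟨π, hπ, rfl⟩
    obtain ⟨v, hv, hle⟩ := hF.exists_half_le (π := π) u hK
    have : v ≤ optPart F u K := le_csSup (bddAbove_partitionalValues u K) hv
    linarith
  linarith

end Existence

/-! ### Nearly extreme priors and the two-peak utility -/

section UpperBound

/-- A probability measure on `[0,1]` with mean `1/2` that puts at most the mass `τ` on the states
that are not within `η` of an end point. -/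
structure IsNearlyExtreme (F : Measure I) (η τ : ℝ) : Prop where
  isProbabilityMeasure : IsProbabilityMeasure F
  mean : ∫ θ, (θ : ℝ) ∂F = 1 / 2
  middle : F.real {θ : I | (θ : ℝ) ∈ Set.Ioo η (1 - η)} ≤ τ

/-- The interim utility that is `1` at the means `δ` and `1 - δ`, and `0` elsewhere. -/
noncomputable def twoPeak (δ : ℝ) : I → I :=
  ({θ : I | (θ : ℝ) = δ ∨ (θ : ℝ) = 1 - δ}).indicator fun _ => 1

theorem upperSemicontinuous_twoPeak (δ : ℝ) : UpperSemicontinuous (twoPeak δ) :=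
  IsClosed.upperSemicontinuous_indicator
    ((isClosed_eq continuous_subtype_val continuous_const).union
      (isClosed_eq continuous_subtype_val continuous_const)) zero_le_one

theorem twoPeak_of_mem {δ : ℝ} {θ : I} (h : (θ : ℝ) = δ ∨ (θ : ℝ) = 1 - δ) : twoPeak δ θ = 1 :=
  Set.indicator_of_mem (s := {θ : I | (θ : ℝ) = δ ∨ (θ : ℝ) = 1 - δ}) h _

theorem twoPeak_of_not_mem {δ : ℝ} {θ : I} (h : ¬((θ : ℝ) = δ ∨ (θ : ℝ) = 1 - δ)) :
    twoPeak δ θ = 0 :=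
  Set.indicator_of_notMem (s := {θ : I | (θ : ℝ) = δ ∨ (θ : ℝ) = 1 - δ}) h _

variable {F : Measure I} {K : ℕ} {π : Kernel I (Fin K)} {η τ δ : ℝ}

theorem measurableSet_middle (η : ℝ) : MeasurableSet {θ : I | (θ : ℝ) ∈ Set.Ioo η (1 - η)} :=
  measurable_subtype_coe measurableSet_Ioo

theorem integral_middle (F : Measure I) (η : ℝ) :
    ∫ θ, ({θ : I | (θ : ℝ) ∈ Set.Ioo η (1 - η)}).indicator (fun _ => (1 : ℝ)) θ ∂F
      = F.real {θ : I | (θ : ℝ) ∈ Set.Ioo η (1 - η)} := by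
  rw [integral_indicator_const _ (measurableSet_middle η)]
  simp

/-- The function `θ - θ ^ 2` is at most `η` near the end points and at most `1 / 4` in the middle.
-/
theorem IsNearlyExtreme.secondMoment (hF : IsNearlyExtreme F η τ) (hη : 0 ≤ η) :
    1 / 2 - η - τ / 4 ≤ ∫ θ : I, (θ : ℝ) ^ 2 ∂F := by
  have := hF.isProbabilityMeasure
  have hind : Integrable (({θ : I | (θ : ℝ) ∈ Set.Ioo η (1 - η)}).indicator fun _ => (1 : ℝ)) F :=
    (integrable_const 1).indicator (measurableSet_middle η)
  have h : ∫ θ : I, ((θ : ℝ) - (θ : ℝ) ^ 2) ∂F ≤ ∫ θ : I,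
      (η + 1 / 4 * ({θ : I | (θ : ℝ) ∈ Set.Ioo η (1 - η)}).indicator (fun _ => (1 : ℝ)) θ) ∂F := by
    refine integral_mono (integrable_of_continuous (by fun_prop))
      ((integrable_const η).add (hind.const_mul _)) fun θ => ?_
    have h0 := θ.2.1
    have h1 := θ.2.2
    simp only [Set.indicator_apply, Set.mem_ofPred_eq]
    split_ifs with hθ
    · nlinarith [sq_nonneg ((θ : ℝ) - 1 / 2)]
    · rcases le_or_gt (θ : ℝ) η with h | h
      · nlinarith
      · have : 1 - η ≤ θ := by
          by_contra! h'
          exact hθ ⟨h, h'⟩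
        nlinarith
  rw [integral_sub integrable_coe (integrable_of_continuous (by fun_prop)), hF.mean,
    integral_add (integrable_const η) (hind.const_mul _), integral_const_mul, integral_middle] at h
  simp only [integral_const, probReal_univ, one_smul] at h
  linarith [hF.middle]

/-- The policy that sends one signal with probability `f θ` and another one otherwise. -/
noncomputable def binaryKernel (f : I → ℝ) (hf : Measurable f) (s₀ s₁ : Fin K) :
    Kernel I (Fin K) where
  toFun θ := ENNReal.ofReal (f θ) • Measure.dirac s₀ + ENNReal.ofReal (1 - f θ) • Measure.dirac s₁
  measurable' := by
    refine Measure.measurable_of_measurable_coe _ fun s _ => ?_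
    simp only [Measure.add_apply, Measure.smul_apply, smul_eq_mul]
    exact (hf.ennreal_ofReal.mul_const _).add ((measurable_const.sub hf).ennreal_ofReal.mul_const _)

theorem binaryKernel_apply (f : I → ℝ) (hf : Measurable f) (s₀ s₁ : Fin K) (θ : I) :
    binaryKernel f hf s₀ s₁ θ
      = ENNReal.ofReal (f θ) • Measure.dirac s₀ + ENNReal.ofReal (1 - f θ) • Measure.dirac s₁ := rfl

theorem isMarkovKernel_binaryKernel {f : I → ℝ} (hf : Measurable f) (s₀ s₁ : Fin K)
    (h : ∀ θ, f θ ∈ Set.Icc (0 : ℝ) 1) : IsMarkovKernel (binaryKernel f hf s₀ s₁) := by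
  refine ⟨fun θ => ⟨?_⟩⟩
  rw [binaryKernel_apply]
  simp only [Measure.add_apply, Measure.smul_apply, smul_eq_mul, measure_univ, mul_one]
  rw [← ENNReal.ofReal_add (h θ).1 (by linarith [(h θ).2]), add_sub_cancel, ENNReal.ofReal_one]

theorem binaryKernel_real_left {f : I → ℝ} (hf : Measurable f) {s₀ s₁ : Fin K} (hs : s₀ ≠ s₁)
    (h : ∀ θ, f θ ∈ Set.Icc (0 : ℝ) 1) (θ : I) : (binaryKernel f hf s₀ s₁ θ).real {s₀} = f θ := by
  simp [measureReal_def, binaryKernel_apply, hs.symm, (h θ).1]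

theorem binaryKernel_real_right {f : I → ℝ} (hf : Measurable f) {s₀ s₁ : Fin K} (hs : s₀ ≠ s₁)
    (h : ∀ θ, f θ ∈ Set.Icc (0 : ℝ) 1) (θ : I) :
    (binaryKernel f hf s₀ s₁ θ).real {s₁} = 1 - f θ := by
  simp [measureReal_def, binaryKernel_apply, hs, (h θ).2]

theorem IsNearlyExtreme.one_le_opt (hF : IsNearlyExtreme F η τ) (hη : 0 ≤ η) (hδ : δ < 1 / 2)
    (hητ : η + τ / 4 ≤ δ / 2) (hK : 2 ≤ K) : 1 ≤ opt F (twoPeak δ) K := by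
  have := hF.isProbabilityMeasure
  set q := ∫ θ : I, (θ : ℝ) ^ 2 ∂F with hq
  have hq1 : 1 / 2 - δ / 2 ≤ q := by linarith [hF.secondMoment hη]
  have hV : 0 < q - 1 / 4 := by linarith
  -- Sending the low signal with probability `1/2 + κ (1/2 - θ)` gives it probability `1/2` and
  -- moment `1/4 - κ (q - 1/4)`, where `q - 1/4` is the variance. This `κ` makes the moment `δ/2`,
  -- so the means are `δ` and `1 - δ`; the second-moment bound ensures `κ ≤ 1`.
  set κ := (1 / 4 - δ / 2) / (q - 1 / 4) with hκ
  have hκ0 : 0 ≤ κ := div_nonneg (by linarith) hV.le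
  have hκ1 : κ ≤ 1 := div_le_one_of_le₀ (by linarith) hV.le
  have hκq : κ * (q - 1 / 4) = 1 / 4 - δ / 2 := div_mul_cancel₀ _ hV.ne'
  have hf : Measurable fun θ : I => 1 / 2 + κ * (1 / 2 - (θ : ℝ)) := by fun_prop
  have hmem : ∀ θ : I, 1 / 2 + κ * (1 / 2 - (θ : ℝ)) ∈ Set.Icc (0 : ℝ) 1 := by
    intro θ
    have h0 := θ.2.1
    have h1 := θ.2.2
    constructor <;> nlinarith
  have hs : (⟨0, by omega⟩ : Fin K) ≠ ⟨1, by omega⟩ := by simp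
  have hπ := isMarkovKernel_binaryKernel hf (⟨0, by omega⟩ : Fin K) ⟨1, by omega⟩ hmem
  have e0 : ∫ θ : I, (1 / 2 + κ * (1 / 2 - (θ : ℝ))) ∂F = 1 / 2 := by
    have : (fun θ : I => 1 / 2 + κ * (1 / 2 - (θ : ℝ)))
        = fun θ : I => (1 / 2 + κ / 2) - κ * (θ : ℝ) := by
      funext θ; ring
    rw [this, integral_sub (integrable_const _) (integrable_coe.const_mul _), integral_const_mul,
      hF.mean]
    simp only [integral_const, probReal_univ, one_smul]
    ring
  have e1 : ∫ θ : I, (θ : ℝ) * (1 / 2 + κ * (1 / 2 - (θ : ℝ))) ∂F = δ / 2 := by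
    have : (fun θ : I => (θ : ℝ) * (1 / 2 + κ * (1 / 2 - (θ : ℝ))))
        = fun θ : I => (1 / 2 + κ / 2) * (θ : ℝ) - κ * (θ : ℝ) ^ 2 := by
      funext θ; ring
    rw [this, integral_sub (integrable_coe.const_mul _)
      (integrable_of_continuous (by fun_prop)), integral_const_mul, integral_const_mul, hF.mean, ← hq]
    linarith
  set π : Kernel I (Fin K) := binaryKernel _ hf ⟨0, by omega⟩ ⟨1, by omega⟩ with hπdef
  have p0 : signalProb F π ⟨0, by omega⟩ = 1 / 2 := by
    unfold signalProb
    simp_rw [hπdef, binaryKernel_real_left hf hs hmem]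
    exact e0
  have m0 : signalMoment F π ⟨0, by omega⟩ = δ / 2 := by
    unfold signalMoment
    simp_rw [hπdef, binaryKernel_real_left hf hs hmem]
    exact e1
  have p1 : signalProb F π ⟨1, by omega⟩ = 1 / 2 := by
    unfold signalProb
    simp_rw [hπdef, binaryKernel_real_right hf hs hmem]
    rw [integral_sub (integrable_const _) (integrable_of_mem_Icc hf hmem), e0]
    norm_num
  have m1 : signalMoment F π ⟨1, by omega⟩ = (1 - δ) / 2 := by
    unfold signalMoment
    simp_rw [hπdef, binaryKernel_real_right hf hs hmem]
    have : (fun θ : I => (θ : ℝ) * (1 - (1 / 2 + κ * (1 / 2 - (θ : ℝ)))))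
        = fun θ : I => (θ : ℝ) - (θ : ℝ) * (1 / 2 + κ * (1 / 2 - (θ : ℝ))) := by
      funext θ; ring
    rw [this, integral_sub integrable_coe (integrable_of_continuous (by fun_prop)), e1, hF.mean]
    ring
  have u0 : twoPeak δ (posteriorMean F π ⟨0, by omega⟩) = 1 := by
    refine twoPeak_of_mem (Or.inl ?_)
    show signalMoment F π _ / signalProb F π _ = δ
    rw [p0, m0]; ring
  have u1 : twoPeak δ (posteriorMean F π ⟨1, by omega⟩) = 1 := by
    refine twoPeak_of_mem (Or.inr ?_)
    show signalMoment F π _ / signalProb F π _ = 1 - δ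
    rw [p1, m1]; ring
  refine le_trans ?_ (le_csSup (bddAbove_schemeValues (F := F) (twoPeak δ) K) ⟨π, hπ, rfl⟩)
  rw [expectedUtility_eq_sum]
  refine le_trans (le_of_eq ?_) (Finset.sum_le_sum_of_subset_of_nonneg
    (Finset.subset_univ {(⟨0, by omega⟩ : Fin K), ⟨1, by omega⟩})
    fun s _ _ => mul_nonneg (signalProb_nonneg s) (twoPeak δ _).2.1)
  rw [Finset.sum_pair hs, u0, u1, p0, p1]
  norm_num

/-- The integral of `g` is small if `g` weights `h` at `δ` but avoids the states where `h` exceeds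
`1 - η`. -/
theorem IsNearlyExtreme.integral_le_of_avoid (hF : IsNearlyExtreme F η τ) (hηδ : η < δ)
    {g h : I → ℝ} (hg : Integrable g F) (hhg : Integrable (fun θ => h θ * g θ) F)
    (hle : ∀ θ, h θ * g θ
      ≤ η * g θ + ({θ : I | (θ : ℝ) ∈ Set.Ioo η (1 - η)}).indicator (fun _ => (1 : ℝ)) θ)
    (heq : ∫ θ, h θ * g θ ∂F = δ * ∫ θ, g θ ∂F) : ∫ θ, g θ ∂F ≤ τ / (δ - η) := by
  have := hF.isProbabilityMeasure
  have hind : Integrable (({θ : I | (θ : ℝ) ∈ Set.Ioo η (1 - η)}).indicator fun _ => (1 : ℝ)) F :=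
    (integrable_const 1).indicator (measurableSet_middle η)
  have h1 := integral_mono hhg ((hg.const_mul η).add hind) hle
  simp only [Pi.add_apply] at h1
  rw [integral_add (hg.const_mul η) hind, integral_const_mul, integral_middle, heq] at h1
  rw [le_div_iff₀ (by linarith)]
  linarith [hF.middle]

/-- The total probability with which a set of signals is sent in a state. -/
noncomputable def sendProb (π : Kernel I (Fin K)) (A : Finset (Fin K)) (θ : I) : ℝ :=
  ∑ s ∈ A, (π θ).real {s}

theorem sendProb_nonneg (A : Finset (Fin K)) (θ : I) : 0 ≤ sendProb π A θ :=
  Finset.sum_nonneg fun _ _ => measureReal_nonneg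

theorem sendProb_le_one [IsMarkovKernel π] (A : Finset (Fin K)) (θ : I) : sendProb π A θ ≤ 1 := by
  rw [← sum_kernel_real (π := π) θ]
  exact Finset.sum_le_sum_of_subset_of_nonneg (Finset.subset_univ A)
    fun _ _ _ => measureReal_nonneg

theorem integrable_sendProb [IsFiniteMeasure F] [IsMarkovKernel π] (A : Finset (Fin K)) :
    Integrable (sendProb π A) F :=
  integrable_finsetSum _ fun s _ => integrable_kernel_real s

theorem integrable_mul_sendProb [IsFiniteMeasure F] [IsMarkovKernel π] (A : Finset (Fin K)) :
    Integrable (fun θ : I => (θ : ℝ) * sendProb π A θ) F := by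
  simp only [sendProb, Finset.mul_sum]
  exact integrable_finsetSum _ fun s _ => integrable_mul_kernel_real s

theorem integral_sendProb [IsFiniteMeasure F] [IsMarkovKernel π] (A : Finset (Fin K)) :
    ∫ θ, sendProb π A θ ∂F = ∑ s ∈ A, signalProb F π s :=
  integral_finsetSum _ fun s _ => integrable_kernel_real s

theorem integral_mul_sendProb [IsProbabilityMeasure F] [IsMarkovKernel π] {A : Finset (Fin K)}
    {x : ℝ} (hA : ∀ s ∈ A, (posteriorMean F π s : ℝ) = x) :
    ∫ θ : I, (θ : ℝ) * sendProb π A θ ∂F = x * ∫ θ, sendProb π A θ ∂F := by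
  rw [integral_sendProb, Finset.mul_sum]
  simp only [sendProb, Finset.mul_sum]
  rw [integral_finsetSum _ fun s _ => integrable_mul_kernel_real s]
  refine Finset.sum_congr rfl fun s hs => ?_
  rw [← hA s hs, posteriorMean_mul_signalProb]
  rfl

theorem sendProb_eq_zero {A : Finset (Fin K)} {θ : I} (h : ∀ s ∈ A, π θ {s} = 0) :
    sendProb π A θ = 0 :=
  Finset.sum_eq_zero fun s hs => by rw [measureReal_def, h s hs, ENNReal.toReal_zero]

theorem posteriorMean_mem_cell [IsProbabilityMeasure F] [IsMarkovKernel π] {s : Fin K} {l r : I}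
    (hs : ∀ θ, π θ {s} ≠ 0 → l ≤ θ ∧ θ ≤ r) (hp : signalProb F π s ≠ 0) :
    (l : ℝ) ≤ posteriorMean F π s ∧ (posteriorMean F π s : ℝ) ≤ r := by
  have hpos : 0 < signalProb F π s := lt_of_le_of_ne (signalProb_nonneg s) hp.symm
  have hm := posteriorMean_mul_signalProb (F := F) (π := π) s
  have hl : l * signalProb F π s ≤ signalMoment F π s := by
    rw [signalProb, ← integral_const_mul]
    refine integral_mono ((integrable_kernel_real s).const_mul _) (integrable_mul_kernel_real s)
      fun θ => ?_
    by_cases h : π θ {s} = 0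
    · simp [measureReal_def, h]
    · exact mul_le_mul_of_nonneg_right (hs θ h).1 measureReal_nonneg
  have hr : signalMoment F π s ≤ r * signalProb F π s := by
    rw [signalProb, ← integral_const_mul]
    refine integral_mono (integrable_mul_kernel_real s) ((integrable_kernel_real s).const_mul _)
      fun θ => ?_
    by_cases h : π θ {s} = 0
    · simp [measureReal_def, h]
    · exact mul_le_mul_of_nonneg_right (hs θ h).2 measureReal_nonneg
  rw [← hm] at hl hr
  exact ⟨le_of_mul_le_mul_right hl hpos, le_of_mul_le_mul_right hr hpos⟩

/-- If no signal with mean `δ` reaches the states near `1`, its mean can be lifted above `η` only by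
the rare middle states. If one does, no signal with mean `1 - δ` reaches the states near `0`, and
the mirrored argument applies. So one of the peaks is negligible; the other is bounded by Markov's
inequality. -/
theorem IsNearlyExtreme.expectedUtility_le (hF : IsNearlyExtreme F η τ) (hη : 0 ≤ η) (hηδ : η < δ)
    (hδ : δ < 1 / 2) [IsMarkovKernel π] (hπ : IsPartitional π) :
    expectedUtility F (twoPeak δ) π ≤ τ / (δ - η) + 1 / 2 / (1 - δ) := by
  have := hF.isProbabilityMeasure
  obtain ⟨a, ha, -, -, hcell⟩ := hπ
  -- Signals of probability zero are excluded, since their posterior mean is a default value that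
  -- need not lie in the cell.
  let L : Finset (Fin K) := {s | (posteriorMean F π s : ℝ) = δ ∧ signalProb F π s ≠ 0}
  let R : Finset (Fin K) := {s | (posteriorMean F π s : ℝ) = 1 - δ ∧ signalProb F π s ≠ 0}
  have hL : ∀ s ∈ L, (posteriorMean F π s : ℝ) = δ := fun s hs => (Finset.mem_filter.1 hs).2.1
  have hR : ∀ s ∈ R, (posteriorMean F π s : ℝ) = 1 - δ := fun s hs => (Finset.mem_filter.1 hs).2.1
  have hU : expectedUtility F (twoPeak δ) π
      ≤ ∫ θ, sendProb π L θ ∂F + ∫ θ, sendProb π R θ ∂F := by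
    rw [expectedUtility_eq_sum, integral_sendProb, integral_sendProb, Finset.sum_filter,
      Finset.sum_filter, ← Finset.sum_add_distrib]
    refine Finset.sum_le_sum fun s _ => ?_
    have hp := signalProb_nonneg (F := F) (π := π) s
    by_cases hp0 : signalProb F π s = 0
    · simp [hp0]
    by_cases h1 : (posteriorMean F π s : ℝ) = δ
    · rw [if_pos ⟨h1, hp0⟩, twoPeak_of_mem (Or.inl h1), Set.Icc.coe_one, mul_one]
      split_ifs <;> linarith
    by_cases h2 : (posteriorMean F π s : ℝ) = 1 - δ
    · rw [if_neg fun h => h1 h.1, if_pos ⟨h2, hp0⟩, twoPeak_of_mem (Or.inr h2), Set.Icc.coe_one,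
        mul_one, zero_add]
    · rw [twoPeak_of_not_mem (not_or.2 ⟨h1, h2⟩), Set.Icc.coe_zero, mul_zero]
      split_ifs <;> linarith
  have hLm := integral_mul_sendProb (F := F) (π := π) hL
  have hRm := integral_mul_sendProb (F := F) (π := π) hR
  have hcomp : ∀ A : Finset (Fin K), Integrable (fun θ : I => (1 - (θ : ℝ)) * sendProb π A θ) F ∧
      ∫ θ : I, (1 - (θ : ℝ)) * sendProb π A θ ∂F
        = ∫ θ, sendProb π A θ ∂F - ∫ θ : I, (θ : ℝ) * sendProb π A θ ∂F := by
    intro A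
    simp only [sub_mul, one_mul]
    exact ⟨(integrable_sendProb A).sub (integrable_mul_sendProb A),
      integral_sub (integrable_sendProb A) (integrable_mul_sendProb A)⟩
  have hmid : ∀ θ : I, 0 ≤ ({θ : I | (θ : ℝ) ∈ Set.Ioo η (1 - η)}).indicator
      (fun _ => (1 : ℝ)) θ := fun θ => Set.indicator_nonneg (fun _ _ => zero_le_one) θ
  have hmid' : ∀ θ : I, (θ : ℝ) ∈ Set.Ioo η (1 - η) →
      ({θ : I | (θ : ℝ) ∈ Set.Ioo η (1 - η)}).indicator (fun _ => (1 : ℝ)) θ = 1 :=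
    fun θ hθ => Set.indicator_of_mem (s := {θ : I | (θ : ℝ) ∈ Set.Ioo η (1 - η)}) hθ _
  by_cases hcase : ∃ i ∈ L, 1 - η ≤ (a i.succ : ℝ)
  · obtain ⟨i, hiL, hi⟩ := hcase
    -- A cell `k` to the right of `i` starts at `1 - η` or later. A cell to its left ends by the
    -- left end of `i`, hence by `δ`, so cannot have mean `1 - δ`. And `k = i` would give one signal
    -- two means.
    have hnone : ∀ k ∈ R, η < (a k.castSucc : ℝ) := by
      intro k hk
      by_contra! hkη
      have hmi := posteriorMean_mem_cell (F := F) (hcell i) (Finset.mem_filter.1 hiL).2.2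
      have hmk := posteriorMean_mem_cell (F := F) (hcell k) (Finset.mem_filter.1 hk).2.2
      rw [hL i hiL] at hmi
      rw [hR k hk] at hmk
      rcases lt_trichotomy i k with hik | hik | hik
      · have : (a i.succ : ℝ) ≤ a k.castSucc := ha (by rw [Fin.le_def]; simpa using hik)
        linarith
      · subst hik
        have := hL i hiL
        have := hR i hk
        linarith
      · have : (a k.succ : ℝ) ≤ a i.castSucc := ha (by rw [Fin.le_def]; simpa using hik)
        linarith
    have hRle : ∫ θ, sendProb π R θ ∂F ≤ τ / (δ - η) := by
      refine hF.integral_le_of_avoid hηδ (h := fun θ => 1 - (θ : ℝ)) (integrable_sendProb R)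
        (hcomp R).1 (fun θ => ?_) (by rw [(hcomp R).2, hRm]; ring)
      have hg0 := sendProb_nonneg (π := π) R θ
      have hg1 := sendProb_le_one (π := π) R θ
      have hθ0 := θ.2.1
      have hm := hmid θ
      rcases le_or_gt (θ : ℝ) η with hθ | hθ
      · rw [sendProb_eq_zero, mul_zero, mul_zero, zero_add]
        · exact hm
        · intro s hs
          by_contra h
          have h1 : (a s.castSucc : ℝ) ≤ θ := (hcell s θ h).1
          linarith [hnone s hs]
      · rcases lt_or_ge (θ : ℝ) (1 - η) with hθ' | hθ'
        · rw [hmid' θ ⟨hθ, hθ'⟩]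
          nlinarith
        · nlinarith
    -- Markov's inequality for `1 - θ`, whose prior mean is `1/2` and whose mean on these signals is
    -- `1 - δ`.
    have hLle : ∫ θ, sendProb π L θ ∂F ≤ 1 / 2 / (1 - δ) := by
      rw [le_div_iff₀ (by linarith)]
      have h1 : ∫ θ : I, (1 - (θ : ℝ)) * sendProb π L θ ∂F ≤ ∫ θ : I, (1 - (θ : ℝ)) ∂F :=
        integral_mono (hcomp L).1 ((integrable_const 1).sub integrable_coe) fun θ =>
          mul_le_of_le_one_right (by linarith [θ.2.2]) (sendProb_le_one L θ)
      rw [(hcomp L).2, hLm, integral_sub (integrable_const 1) integrable_coe, hF.mean] at h1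
      simp only [integral_const, probReal_univ, one_smul] at h1
      linarith
    linarith
  · push Not at hcase
    have hLle : ∫ θ, sendProb π L θ ∂F ≤ τ / (δ - η) := by
      refine hF.integral_le_of_avoid hηδ (h := fun θ => (θ : ℝ)) (integrable_sendProb L)
        (integrable_mul_sendProb L) (fun θ => ?_) hLm
      have hg0 := sendProb_nonneg (π := π) L θ
      have hg1 := sendProb_le_one (π := π) L θ
      have hθ0 := θ.2.1
      have hθ1 := θ.2.2
      have hm := hmid θ
      rcases lt_or_ge (θ : ℝ) (1 - η) with hθ | hθ
      · rcases le_or_gt (θ : ℝ) η with hθ' | hθ'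
        · nlinarith
        · rw [hmid' θ ⟨hθ', hθ⟩]
          nlinarith
      · rw [sendProb_eq_zero, mul_zero, mul_zero, zero_add]
        · exact hm
        · intro s hs
          by_contra h
          have h1 : (θ : ℝ) ≤ a s.succ := (hcell s θ h).2
          linarith [hcase s hs]
    have hRle : ∫ θ, sendProb π R θ ∂F ≤ 1 / 2 / (1 - δ) := by
      rw [le_div_iff₀ (by linarith)]
      have h1 : ∫ θ : I, (θ : ℝ) * sendProb π R θ ∂F ≤ ∫ θ : I, (θ : ℝ) ∂F :=
        integral_mono (integrable_mul_sendProb R) integrable_coe fun θ =>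
          mul_le_of_le_one_right θ.2.1 (sendProb_le_one R θ)
      rw [hRm, hF.mean] at h1
      linarith
    linarith

theorem IsNearlyExtreme.poe_le (hδ0 : 0 < δ) (hδ : δ ≤ 1 / 4)
    (hF : IsNearlyExtreme F (δ ^ 2) (δ ^ 2)) (hK : 2 ≤ K) :
    0 < opt F (twoPeak δ) K ∧ poe F (twoPeak δ) K ≤ 1 / 2 + 2 * δ := by
  have := hF.isProbabilityMeasure
  have hopt : 1 ≤ opt F (twoPeak δ) K :=
    hF.one_le_opt (sq_nonneg δ) (by linarith) (by nlinarith) hK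
  have hgreatest := isGreatest_optPart (F := F) (upperSemicontinuous_twoPeak δ)
    (K := K) (by omega)
  obtain ⟨π, hπ, hpart, hval⟩ := hgreatest.1
  have h0 : 0 ≤ optPart F (twoPeak δ) K := by
    rw [← hval]; exact expectedUtility_nonneg _
  have h1 := hF.expectedUtility_le (δ := δ) (sq_nonneg δ) (by nlinarith) (by linarith) hpart
  rw [hval] at h1
  refine ⟨by linarith, (div_le_self h0 hopt).trans (h1.trans ?_)⟩
  -- With `η = τ = δ ^ 2` the bound becomes `(1/2 + δ) / (1 - δ)`, which is at most `1/2 + 2 * δ`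
  -- exactly because `δ ≤ 1/4`.
  have e1 : δ ^ 2 / (δ - δ ^ 2) = δ / (1 - δ) := by
    rw [div_eq_div_iff (by nlinarith) (by linarith)]
    ring
  rw [e1, ← add_div, div_le_iff₀ (by linarith)]
  nlinarith

end UpperBound

/-! ### Continuous and three-point priors that are nearly extreme -/

section Priors

/-- The uniform distribution with weight `τ`, mixed with the uniform distribution on
`[0,η] ∪ [1-η,1]`. -/
noncomputable def endsPrior (η : I) (τ : ℝ) : Measure I :=
  ENNReal.ofReal τ • volume + ENNReal.ofReal ((1 - τ) / (2 * η)) •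
    (volume.restrict (Set.Iic η) + volume.restrict (Set.Ici (σ η)))

variable {η : I} {τ : ℝ}

/-- A relatively open set may contain an end point, but end points are limits of interior points, so
the set meets `(0,1)` in a nonempty open subset of the line. -/
theorem isOpenPosMeasure_volume_unitInterval : (volume : Measure I).IsOpenPosMeasure := by
  refine ⟨fun U hU ⟨x, hx⟩ h0 => ?_⟩
  obtain ⟨V, hV, rfl⟩ := isOpen_induced_iff.1 hU
  have hcl : (x : ℝ) ∈ closure (Set.Ioo (0 : ℝ) 1) := by
    rw [closure_Ioo zero_ne_one]
    exact x.2
  obtain ⟨y, hyV, hy⟩ := mem_closure_iff.1 hcl V hV hx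
  have hpos : 0 < volume (V ∩ Set.Ioo (0 : ℝ) 1) :=
    (hV.inter isOpen_Ioo).measure_pos _ ⟨y, hyV, hy⟩
  rw [unitInterval.volume_apply] at h0
  refine hpos.ne' (measure_mono_null ?_ h0)
  rintro z ⟨hzV, hz⟩
  exact ⟨⟨z, hz.1.le, hz.2.le⟩, hzV, rfl⟩

theorem isProbabilityMeasure_endsPrior (hη : 0 < (η : ℝ)) (hτ0 : 0 ≤ τ) (hτ1 : τ ≤ 1) :
    IsProbabilityMeasure (endsPrior η τ) := by
  refine ⟨?_⟩
  have h1 : 0 ≤ (1 - τ) / (2 * η) := div_nonneg (by linarith) (by linarith)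
  rw [endsPrior]
  simp only [Measure.add_apply, Measure.smul_apply, smul_eq_mul, measure_univ, mul_one,
    Measure.restrict_apply_univ, unitInterval.volume_Iic, unitInterval.volume_Ici,
    unitInterval.coe_symm_eq, sub_sub_cancel]
  rw [← ENNReal.ofReal_add hη.le hη.le, ← ENNReal.ofReal_mul h1,
    ← ENNReal.ofReal_add hτ0 (mul_nonneg h1 (by linarith)), ← ENNReal.ofReal_one]
  congr 1
  field_simp
  ring

theorem isContinuousPrior_endsPrior (hη : 0 < (η : ℝ)) (hτ0 : 0 < τ) (hτ1 : τ ≤ 1) :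
    IsContinuousPrior (endsPrior η τ) := by
  refine ⟨isProbabilityMeasure_endsPrior hη hτ0.le hτ1, ?_, ?_⟩
  · refine (Measure.AbsolutelyContinuous.rfl.smul_left _).add_left
      (Measure.AbsolutelyContinuous.smul_left ?_ _)
    exact Measure.restrict_le_self.absolutelyContinuous.add_left
      Measure.restrict_le_self.absolutelyContinuous
  · have := isOpenPosMeasure_volume_unitInterval
    refine Measure.AbsolutelyContinuous.isOpenPosMeasure (μ := volume) ?_
    refine Measure.AbsolutelyContinuous.mk fun s _ hs => ?_
    rw [endsPrior, Measure.add_apply, Measure.smul_apply, smul_eq_mul, add_eq_zero,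
      mul_eq_zero, ENNReal.ofReal_eq_zero] at hs
    exact hs.1.resolve_left (not_le.2 hτ0)

theorem integral_volume_unitInterval : ∫ θ : I, (θ : ℝ) = 1 / 2 := by
  have h := unitInterval.measurePreserving_symm.integral_comp
    unitInterval.symmMeasurableEquiv.measurableEmbedding fun θ : I => (θ : ℝ)
  simp only [unitInterval.coe_symm_eq] at h
  rw [integral_sub (integrable_const _) integrable_coe] at h
  simp only [integral_const, probReal_univ, one_smul] at h
  linarith

/-- The reflection `σ` exchanges the two ends and turns `θ` into `1 - θ`, so the two integrals add
up to the length `η` of one end. -/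
theorem setIntegral_ends (η : I) :
    (∫ θ in Set.Iic η, (θ : ℝ)) + (∫ θ in Set.Ici (σ η), (θ : ℝ)) = η := by
  have h := unitInterval.measurePreserving_symm.setIntegral_preimage_emb
    unitInterval.symmMeasurableEquiv.measurableEmbedding (fun θ : I => (θ : ℝ)) (Set.Ici (σ η))
  have hpre : σ ⁻¹' Set.Ici (σ η) = Set.Iic η := by
    ext θ
    simp
  rw [hpre] at h
  simp only [unitInterval.coe_symm_eq] at h
  rw [← h, integral_sub (integrable_const 1) integrable_coe, add_sub_cancel]
  simp [measureReal_def, unitInterval.volume_Iic, η.2.1]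

theorem isNearlyExtreme_endsPrior (hη : 0 < (η : ℝ)) (hτ0 : 0 ≤ τ) (hτ1 : τ ≤ 1) :
    IsNearlyExtreme (endsPrior η τ) η τ := by
  have h1 : 0 ≤ (1 - τ) / (2 * η) := div_nonneg (by linarith) (by linarith)
  refine ⟨isProbabilityMeasure_endsPrior hη hτ0 hτ1, ?_, ?_⟩
  · have hi : ∀ s : Set I, Integrable (fun θ : I => (θ : ℝ)) (volume.restrict s) :=
      fun s => integrable_coe
    rw [endsPrior, integral_add_measure (integrable_coe.smul_measure ENNReal.ofReal_ne_top)
      (((hi _).add_measure (hi _)).smul_measure ENNReal.ofReal_ne_top),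
      integral_smul_measure, integral_smul_measure, integral_add_measure (hi _) (hi _),
      integral_volume_unitInterval, setIntegral_ends, ENNReal.toReal_ofReal hτ0,
      ENNReal.toReal_ofReal h1]
    simp only [smul_eq_mul]
    field_simp
    ring
  · refine ENNReal.toReal_le_of_le_ofReal hτ0 ?_
    have e1 : {θ : I | (θ : ℝ) ∈ Set.Ioo (η : ℝ) (1 - η)} ∩ Set.Iic η = ∅ :=
      Set.eq_empty_of_forall_notMem fun θ hθ => absurd hθ.2 (not_le.2 hθ.1.1)
    have e2 : {θ : I | (θ : ℝ) ∈ Set.Ioo (η : ℝ) (1 - η)} ∩ Set.Ici (σ η) = ∅ :=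
      Set.eq_empty_of_forall_notMem fun θ hθ => absurd hθ.2 (not_le.2 hθ.1.2)
    rw [endsPrior, Measure.add_apply, Measure.smul_apply, Measure.smul_apply, Measure.add_apply,
      Measure.restrict_apply (measurableSet_middle _), Measure.restrict_apply (measurableSet_middle _),
      e1, e2, measure_empty, add_zero, smul_zero, add_zero]
    exact mul_le_of_le_one_right' prob_le_one

/-- The midpoint of `[0,1]`. -/
noncomputable def midpointState : I := ⟨1 / 2, by norm_num, by norm_num⟩

/-- The prior on `0`, `1/2` and `1` that puts the mass `τ` on `1/2` and equal mass on `0`, `1`. -/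
noncomputable def threePointPrior (τ : ℝ) : Measure I :=
  ENNReal.ofReal ((1 - τ) / 2) • Measure.dirac 0 + ENNReal.ofReal τ • Measure.dirac midpointState
    + ENNReal.ofReal ((1 - τ) / 2) • Measure.dirac 1

theorem zero_ne_midpointState : (0 : I) ≠ midpointState := fun h => by
  have := congrArg Subtype.val h
  norm_num [midpointState] at this

theorem one_ne_midpointState : (1 : I) ≠ midpointState := fun h => by
  have := congrArg Subtype.val h
  norm_num [midpointState] at this

theorem isProbabilityMeasure_threePointPrior (hτ0 : 0 ≤ τ) (hτ1 : τ ≤ 1) :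
    IsProbabilityMeasure (threePointPrior τ) := by
  refine ⟨?_⟩
  simp only [threePointPrior, Measure.add_apply, Measure.smul_apply, smul_eq_mul, measure_univ,
    mul_one]
  rw [← ENNReal.ofReal_add (by linarith) hτ0, ← ENNReal.ofReal_add (by linarith) (by linarith),
    ← ENNReal.ofReal_one]
  congr 1
  ring

theorem isThreePointPrior_threePointPrior (hτ0 : 0 < τ) (hτ1 : τ < 1) :
    IsThreePointPrior (threePointPrior τ) := by
  refine ⟨isProbabilityMeasure_threePointPrior hτ0.le hτ1.le, {0, midpointState, 1}, ?_, ?_, ?_⟩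
  · exact Finset.card_eq_three.2 ⟨0, midpointState, 1, zero_ne_midpointState, zero_ne_one,
      one_ne_midpointState.symm, rfl⟩
  · simp [threePointPrior]
  · have h : 0 < (1 - τ) / 2 := by linarith
    intro x hx
    simp only [Finset.mem_insert, Finset.mem_singleton] at hx
    rcases hx with rfl | rfl | rfl <;>
      simp [threePointPrior, h, hτ0, zero_ne_midpointState, one_ne_midpointState]

theorem isNearlyExtreme_threePointPrior {η : ℝ} (hη : 0 ≤ η) (hτ0 : 0 ≤ τ) (hτ1 : τ ≤ 1) :
    IsNearlyExtreme (threePointPrior τ) η τ := by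
  refine ⟨isProbabilityMeasure_threePointPrior hτ0 hτ1, ?_, ?_⟩
  · have hi : ∀ (c : ℝ) (x : I),
        Integrable (fun θ : I => (θ : ℝ)) (ENNReal.ofReal c • Measure.dirac x) :=
      fun c x => integrable_coe.smul_measure ENNReal.ofReal_ne_top
    rw [threePointPrior, integral_add_measure ((hi _ _).add_measure (hi _ _)) (hi _ _),
      integral_add_measure (hi _ _) (hi _ _)]
    simp only [integral_smul_measure, integral_dirac, smul_eq_mul, Set.Icc.coe_zero,
      Set.Icc.coe_one, mul_zero, mul_one, zero_add, midpointState]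
    rw [ENNReal.toReal_ofReal hτ0, ENNReal.toReal_ofReal (by linarith)]
    ring
  · refine ENNReal.toReal_le_of_le_ofReal hτ0 ?_
    have h0 : (0 : I) ∉ {θ : I | (θ : ℝ) ∈ Set.Ioo η (1 - η)} :=
      fun h => absurd h.1 (not_lt.2 hη)
    have h1 : (1 : I) ∉ {θ : I | (θ : ℝ) ∈ Set.Ioo η (1 - η)} := fun h => by
      have : (1 : ℝ) < 1 - η := h.2
      linarith
    rw [threePointPrior, Measure.add_apply, Measure.add_apply, Measure.smul_apply,
      Measure.smul_apply, Measure.smul_apply, Measure.dirac_apply' 0 (measurableSet_middle η),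
      Measure.dirac_apply' 1 (measurableSet_middle η), Set.indicator_of_notMem h0,
      Set.indicator_of_notMem h1, smul_zero, zero_add, add_zero]
    exact mul_le_of_le_one_right' prob_le_one

theorem exists_continuousPrior_poe_le {ε : ℝ} (hε : 0 < ε) :
    ∃ (F : Measure I) (u : I → I), IsContinuousPrior F ∧ UpperSemicontinuous u ∧
      ∀ K : ℕ, 2 ≤ K → 0 < opt F u K ∧ poe F u K ≤ 1 / 2 + ε := by
  set δ := min (1 / 4) (ε / 2) with hδ
  have hδ0 : 0 < δ := lt_min (by norm_num) (by linarith)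
  have hδ4 : δ ≤ 1 / 4 := min_le_left _ _
  have hδε : δ ≤ ε / 2 := min_le_right _ _
  have hδ1 : δ ^ 2 ≤ 1 := by nlinarith
  have hsq : 0 < δ ^ 2 := by positivity
  let η : I := ⟨δ ^ 2, hsq.le, hδ1⟩
  have hF : IsNearlyExtreme (endsPrior η (δ ^ 2)) (δ ^ 2) (δ ^ 2) :=
    isNearlyExtreme_endsPrior (η := η) hsq hsq.le hδ1
  refine ⟨endsPrior η (δ ^ 2), twoPeak δ, isContinuousPrior_endsPrior hsq hsq hδ1,
    upperSemicontinuous_twoPeak δ, fun K hK => ?_⟩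
  have h := hF.poe_le hδ0 hδ4 hK
  exact ⟨h.1, h.2.trans (by linarith)⟩

theorem exists_threePointPrior_poe_le {ε : ℝ} (hε : 0 < ε) :
    ∃ (F : Measure I) (u : I → I), IsThreePointPrior F ∧ UpperSemicontinuous u ∧
      ∀ K : ℕ, 2 ≤ K → OptimaAttained F u K ∧ 0 < opt F u K ∧ poe F u K ≤ 1 / 2 + ε := by
  set δ := min (1 / 4) (ε / 2) with hδ
  have hδ0 : 0 < δ := lt_min (by norm_num) (by linarith)
  have hδ4 : δ ≤ 1 / 4 := min_le_left _ _
  have hδε : δ ≤ ε / 2 := min_le_right _ _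
  have hδ1 : δ ^ 2 < 1 := by nlinarith
  have hsq : 0 < δ ^ 2 := by positivity
  have hF : IsNearlyExtreme (threePointPrior (δ ^ 2)) (δ ^ 2) (δ ^ 2) :=
    isNearlyExtreme_threePointPrior hsq.le hsq.le hδ1.le
  have := hF.isProbabilityMeasure
  refine ⟨threePointPrior (δ ^ 2), twoPeak δ, isThreePointPrior_threePointPrior hsq hδ1,
    upperSemicontinuous_twoPeak δ, fun K hK => ?_⟩
  have h := hF.poe_le hδ0 hδ4 hK
  exact ⟨optimaAttained (upperSemicontinuous_twoPeak δ) (by omega), h.1, h.2.trans (by linarith)⟩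

end Priors

end InfoDesign

/-! ### The theorem -/

theorem theorem1 :
    -- lower bound, for every instance with a continuous full-support prior
    (∀ (F : Measure I) (u : I → I), InfoDesign.IsContinuousPrior F → UpperSemicontinuous u →
      ∀ K : ℕ, 2 ≤ K →
        InfoDesign.OptimaAttained F u K ∧
        (1 / 2 : ℝ) * InfoDesign.opt F u K ≤ InfoDesign.optPart F u K) ∧
    -- upper bound: one instance, with a continuous full-support prior, for all `K`
    (∀ ε : ℝ, 0 < ε → ∃ (F : Measure I) (u : I → I),
      InfoDesign.IsContinuousPrior F ∧ UpperSemicontinuous u ∧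
      ∀ K : ℕ, 2 ≤ K → 0 < InfoDesign.opt F u K ∧ InfoDesign.poe F u K ≤ 1 / 2 + ε) ∧
    -- upper bound: one instance, with a three-point prior, for all `K`
    (∀ ε : ℝ, 0 < ε → ∃ (F : Measure I) (u : I → I),
      InfoDesign.IsThreePointPrior F ∧ UpperSemicontinuous u ∧
      ∀ K : ℕ, 2 ≤ K → InfoDesign.OptimaAttained F u K ∧
        0 < InfoDesign.opt F u K ∧ InfoDesign.poe F u K ≤ 1 / 2 + ε) ∧
    -- the worst-case price of explainability is exactly one half
    (∀ K : ℕ, 2 ≤ K →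
      IsGLB {r : ℝ | ∃ (F : Measure I) (u : I → I),
        InfoDesign.IsContinuousPrior F ∧ UpperSemicontinuous u ∧
        0 < InfoDesign.opt F u K ∧ r = InfoDesign.poe F u K} (1 / 2)) := by
  refine ⟨fun F u hF hu K hK => ?_, fun ε hε => InfoDesign.exists_continuousPrior_poe_le hε,
    fun ε hε => InfoDesign.exists_threePointPrior_poe_le hε, fun K hK => ⟨?_, fun b hb => ?_⟩⟩
  · have := hF.isProbabilityMeasure
    exact ⟨InfoDesign.optimaAttained hu (by omega), hF.half_opt_le u (by omega)⟩
  · rintro r ⟨F, u, hF, -, hpos, rfl⟩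
    rw [InfoDesign.poe, le_div_iff₀ hpos]
    exact hF.half_opt_le u (by omega)
  · refine le_of_forall_pos_le_add fun ε hε => ?_
    obtain ⟨F, u, hF, hu, h⟩ := InfoDesign.exists_continuousPrior_poe_le hε
    exact (hb ⟨F, u, hF, hu, (h K hK).1, rfl⟩).trans (h K hK).2
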